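/- **Theorem.** Let $0\le\alpha\le 1$. Consider the two-user $(2,1,1)$ Gaussian MISO broadcast channel with confidential messages, delayed CSIT and alternating topology: for $t=1,\dots,n$, $$y_t=\sqrt{\rho^{A_{1,t}}}\,\mathbf h_t\mathbf x_t+n_{1t},\qquad z_t=\sqrt{\rho^{A_{2,t}}}\,\mathbf g_t\mathbf x_t+n_{2t},$$ where $\mathbf x_t\in\mathbb C^{2}$ with $\|\mathbf x_t\|^2\le 1$, the noises are independent i.i.d. $\mathcal{CN}(0,1)$ sequences, and $\mathbf S_t=(\mathbf h_t,\mathbf g_t)$, with $\mathbf h_t,\mathbf g_t\in\mathbb C^{1\times 2}$, are i.i.d. in $t$ and independent of the noises. Assume that the matrix with rows $\mathbf h_t,\mathbf g_t$ has full rank almost surely, that two independent copies of $\mathbf h_t$ are almost surely linearly independent, that the same holds for $\mathbf g_t$, and that $\mathbb E\|\mathbf h_t\|^2<\infty$ and $\mathbb E\|\mathbf g_t\|^2<\infty$. Each link is strong (exponent $1$) or weak (exponent $\alpha$). The topology, i.e. the assignment of classes to the two links at times $1,\dots,n$, is deterministic and known to all nodes, and as $n\to\infty$ the fraction of time during which the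 link classes to receivers 1 and 2 are (strong, strong), (strong, weak), (weak, strong), (weak, weak) tends to $\lambda_{11},\lambda_{1\alpha},\lambda_{\alpha1},\lambda_{\alpha\alpha}$, respectively. A code of length $n$ consists of independent messages $W_1,W_2$, uniform on finite sets $\mathcal W_1,\mathcal W_2$; a stochastic encoder, in which $\mathbf x_t$ is a function of $W_1,W_2,\mathbf S^{t-1}$ and of a local random variable independent of the messages, channel states and noises; and decoders producing $\hat W_1$ from $(y^n,\mathbf S^{n-1},\mathbf h_n)$ and $\hat W_2$ from $(z^n,\mathbf S^{n-1},\mathbf g_n)$. A pair $(d_1,d_2)$ is achievable if for every sufficiently large $\rho$ there is a sequence of codes, indexed by $n$, such that for $i=1,2$ $$\limsup_{n\to\infty}\Pr\{\hat W_i\ne W_i\}=0,\qquad \limsup_{n\to\infty}\tfrac1n I(W_2;y^n,\mathbf S^{n-1},\mathbf h_n)=\limsup_{n\to\infty}\tfrac1n I(W_1;z^n,\mathbf S^{n-1},\mathbf g_n)=0,$$ $$\liminf_{\rho\to\infty}\liminf_{n\to\infty}\frac{\log|\mathcal W_i(n,\rho)|}{n\log\rho}\ge d_i .$$ Then every achievable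 GSDoF pair with $d_1,d_2\ge 0$ satisfies $$3d_1+d_2\le(3-\alpha)\lambda_{1\alpha}+2(\lambda_{11}+\alpha\lambda_{\alpha\alpha})+(1+\alpha)\lambda_{\alpha1},$$ $$d_1+3d_2\le(3-\alpha)\lambda_{\alpha1}+2(\lambda_{11}+\alpha\lambda_{\alpha\alpha})+(1+\alpha)\lambda_{1\alpha}.$$ -/

import Mathlib

open MeasureTheory Filter Topology
open scoped ENNReal NNReal

noncomputable section

namespace MisoBC

/-- The two link classes: a strong link has power exponent `1`, a weak one `α`. -/
inductive Link : Type
  | strong : Link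
  | weak : Link

/-- Power exponent of a link. -/
def Link.exponent (α : ℝ) : Link → ℝ
  | Link.strong => 1
  | Link.weak => α

/-- Vectors in `ℂ²`: channel (row) vectors and channel inputs. -/
abbrev Vec : Type := Fin 2 → ℂ

/-- A channel state `S = (h, g)`: `h` is the channel vector of receiver 1 and `g` that of
receiver 2. -/
abbrev State : Type := Vec × Vec

/-- A topology schedule: for each block length `n` and each time `t < n`, the classes of the
links to receiver 1 and to receiver 2. -/
abbrev Schedule : Type := (n : ℕ) → Fin n → Link × Link

/-- `lam a b` is the (asymptotic) fraction of time spent in topology state `(a, b)`. -/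
def HasFractions (A : Schedule) (lam : Link → Link → ℝ) : Prop :=
  ∀ a b : Link, Tendsto
    (fun n : ℕ => (Nat.card {t : Fin n // A n t = (a, b)} : ℝ) / (n : ℝ)) atTop (𝓝 (lam a b))

/-- The `2 × 2` matrix with rows `u` and `v` is invertible. -/
def FullRank (u v : Vec) : Prop := (Matrix.of ![u, v]).det ≠ 0

/-- Standing assumptions on the law `ν` of the channel state at one time instant. The states at
different times are independent with law `ν` (see `Code.law`); `h` and `g` at the same time
need not be independent. -/
structure IsFadingLaw (ν : Measure State) : Prop where
  /-- the channel state matrix is almost surely of full rank -/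
  full_rank : ∀ᵐ s ∂ν, FullRank s.1 s.2
  /-- two independent channel vectors of receiver 1 are almost surely linearly independent -/
  full_rank_fst : ∀ᵐ p ∂(ν.prod ν), FullRank p.1.1 p.2.1
  /-- two independent channel vectors of receiver 2 are almost surely linearly independent -/
  full_rank_snd : ∀ᵐ p ∂(ν.prod ν), FullRank p.1.2 p.2.2
  /-- the channel vector of receiver 1 has finite average power -/
  power_fst : Integrable (fun s : State => ∑ i, ‖s.1 i‖ ^ 2) ν
  /-- the channel vector of receiver 2 has finite average power -/
  power_snd : Integrable (fun s : State => ∑ i, ‖s.2 i‖ ^ 2) ν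

/-- The circularly symmetric complex Gaussian law `CN(0,1)`: real and imaginary parts are
independent, each with law `N(0,1/2)`. -/
def stdComplexGaussian : Measure ℂ :=
  ((ProbabilityTheory.gaussianReal 0 (1 / 2)).prod (ProbabilityTheory.gaussianReal 0 (1 / 2))).map
    Complex.measurableEquivRealProd.symm

/-- Mutual information (in nats) of two random variables on a probability space: the
Kullback-Leibler divergence of the joint law from the product of the marginal laws. -/
def mutualInfo {Ω X Y : Type} [MeasurableSpace Ω] [MeasurableSpace X] [MeasurableSpace Y]
    (P : Measure Ω) (U : Ω → X) (V : Ω → Y) : ℝ≥0∞ :=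
  InformationTheory.klDiv (P.map (fun ω => (U ω, V ω))) ((P.map U).prod (P.map V))

/-- What a receiver has seen after `n` channel uses: its outputs, its own channel vectors up to
time `n`, and the channel vectors of the other receiver up to time `n - 1`. -/
abbrev View (n : ℕ) : Type := (Fin n → ℂ) × (Fin n → Vec) × (Fin (n - 1) → Vec)

/-- The channel states strictly before time `t`. -/
def pastStates {n : ℕ} (s : Fin n → State) (t : Fin n) : Fin (t : ℕ) → State :=
  fun k => s (Fin.castLE t.isLt.le k)

/-- A code of block length `n`. The messages are uniform on `Fin M₁` and `Fin M₂`. The stochastic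
encoder uses a local random source with values in `Θ` (shared by all time instants), the messages
and, at time `t`, the channel states strictly before `t`. -/
structure Code (n : ℕ) where
  /-- number of messages for receiver 1 -/
  M₁ : ℕ
  /-- number of messages for receiver 2 -/
  M₂ : ℕ
  pos₁ : 0 < M₁
  pos₂ : 0 < M₂
  /-- values of the local randomness of the transmitter -/
  Θ : Type
  [measΘ : MeasurableSpace Θ]
  /-- law of the local randomness -/
  lawΘ : Measure Θ
  [probΘ : IsProbabilityMeasure lawΘ]
  /-- the encoders -/
  enc : (t : Fin n) → Fin M₁ → Fin M₂ → (Fin (t : ℕ) → State) → Θ → Vec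
  measurable_enc : ∀ (t : Fin n) (w₁ : Fin M₁) (w₂ : Fin M₂),
    Measurable (fun p : (Fin (t : ℕ) → State) × Θ => enc t w₁ w₂ p.1 p.2)
  /-- input power constraint -/
  power : ∀ (t : Fin n) (w₁ : Fin M₁) (w₂ : Fin M₂) (s : Fin (t : ℕ) → State) (θ : Θ),
    ∑ i, ‖enc t w₁ w₂ s θ i‖ ^ 2 ≤ 1
  /-- decoder of receiver 1 -/
  dec₁ : View n → Fin M₁
  measurable_dec₁ : Measurable dec₁
  /-- decoder of receiver 2 -/
  dec₂ : View n → Fin M₂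
  measurable_dec₂ : Measurable dec₂

attribute [instance] Code.measΘ Code.probΘ

namespace Code

variable {n : ℕ} (C : Code n)

/-- Sample space: messages, local randomness, channel states, noises at the two receivers. -/
abbrev Sample : Type :=
  ((Fin C.M₁ × Fin C.M₂) × C.Θ) × (Fin n → State) × (Fin n → ℂ) × (Fin n → ℂ)

/-- All sources of randomness are independent: the messages are uniform, the channel states are
i.i.d. with law `ν`, and the noises are i.i.d. `CN(0,1)`. -/
def law (ν : Measure State) : Measure C.Sample :=
  (((ProbabilityTheory.uniformOn Set.univ).prod (ProbabilityTheory.uniformOn Set.univ)).prod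
      C.lawΘ).prod
    ((Measure.pi fun _ : Fin n => ν).prod
      ((Measure.pi fun _ : Fin n => stdComplexGaussian).prod
        (Measure.pi fun _ : Fin n => stdComplexGaussian)))

/-- Message for receiver 1. -/
def msg₁ (ω : C.Sample) : Fin C.M₁ := ω.1.1.1

/-- Message for receiver 2. -/
def msg₂ (ω : C.Sample) : Fin C.M₂ := ω.1.1.2

/-- Channel states. -/
def states (ω : C.Sample) : Fin n → State := ω.2.1

/-- Channel input at time `t`. -/
def input (ω : C.Sample) (t : Fin n) : Vec :=
  C.enc t (C.msg₁ ω) (C.msg₂ ω) (pastStates (C.states ω) t) ω.1.2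

/-- Output `y` at receiver 1. -/
def output₁ (α : ℝ) (A : Fin n → Link × Link) (ρ : ℝ) (ω : C.Sample) (t : Fin n) : ℂ :=
  (Real.sqrt (ρ ^ (A t).1.exponent α) : ℂ) * ∑ i, (C.states ω t).1 i * C.input ω t i
    + ω.2.2.1 t

/-- Output `z` at receiver 2. -/
def output₂ (α : ℝ) (A : Fin n → Link × Link) (ρ : ℝ) (ω : C.Sample) (t : Fin n) : ℂ :=
  (Real.sqrt (ρ ^ (A t).2.exponent α) : ℂ) * ∑ i, (C.states ω t).2 i * C.input ω t i
    + ω.2.2.2 t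

/-- Everything known to receiver 1 at the end of the block. -/
def view₁ (α : ℝ) (A : Fin n → Link × Link) (ρ : ℝ) (ω : C.Sample) : View n :=
  (C.output₁ α A ρ ω, fun t => (C.states ω t).1,
    fun t => (C.states ω (Fin.castLE (Nat.sub_le n 1) t)).2)

/-- Everything known to receiver 2 at the end of the block. -/
def view₂ (α : ℝ) (A : Fin n → Link × Link) (ρ : ℝ) (ω : C.Sample) : View n :=
  (C.output₂ α A ρ ω, fun t => (C.states ω t).2,
    fun t => (C.states ω (Fin.castLE (Nat.sub_le n 1) t)).1)

/-- Error probability at receiver 1. -/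
def err₁ (ν : Measure State) (α : ℝ) (A : Fin n → Link × Link) (ρ : ℝ) : ℝ≥0∞ :=
  C.law ν {ω | C.dec₁ (C.view₁ α A ρ ω) ≠ C.msg₁ ω}

/-- Error probability at receiver 2. -/
def err₂ (ν : Measure State) (α : ℝ) (A : Fin n → Link × Link) (ρ : ℝ) : ℝ≥0∞ :=
  C.law ν {ω | C.dec₂ (C.view₂ α A ρ ω) ≠ C.msg₂ ω}

/-- Leakage of the message for receiver 1 to receiver 2. -/
def leak₁ (ν : Measure State) (α : ℝ) (A : Fin n → Link × Link) (ρ : ℝ) : ℝ≥0∞ :=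
  mutualInfo (C.law ν) C.msg₁ (C.view₂ α A ρ)

/-- Leakage of the message for receiver 2 to receiver 1. -/
def leak₂ (ν : Measure State) (α : ℝ) (A : Fin n → Link × Link) (ρ : ℝ) : ℝ≥0∞ :=
  mutualInfo (C.law ν) C.msg₂ (C.view₁ α A ρ)

end Code

/-- Normalized asymptotic rate of codebook sizes `M ρ n`: the lower limit, as `ρ → ∞`, of
`liminf_{n → ∞} log M / (n log ρ)`. It is the limit whenever the limit exists. -/
def gsdofOf (M : ℝ → ℕ → ℕ) : EReal :=
  liminf (fun ρ : ℝ => liminf (fun n : ℕ =>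
    ((Real.log (M ρ n) / (n * Real.log ρ) : ℝ) : EReal)) atTop) atTop

/-- Achievability of a GSDoF pair: for every large power `ρ` there is a sequence of codes, indexed
by the block length, with vanishing error probabilities and vanishing normalized leakages, whose
rates scale as prescribed when `ρ → ∞`. -/
def Achievable (ν : Measure State) (α : ℝ) (A : Schedule) (d : ℝ × ℝ) : Prop :=
  ∃ C : (ρ : ℝ) → (n : ℕ) → Code n,
    (∀ᶠ ρ : ℝ in atTop,
      limsup (fun n => (C ρ n).err₁ ν α (A n) ρ) atTop = 0 ∧
      limsup (fun n => (C ρ n).err₂ ν α (A n) ρ) atTop = 0 ∧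
      limsup (fun n : ℕ => (C ρ n).leak₂ ν α (A n) ρ / (n : ℝ≥0∞)) atTop = 0 ∧
      limsup (fun n : ℕ => (C ρ n).leak₁ ν α (A n) ρ / (n : ℝ≥0∞)) atTop = 0) ∧
    (d.1 : EReal) ≤ gsdofOf (fun ρ n => (C ρ n).M₁) ∧
    (d.2 : EReal) ≤ gsdofOf (fun ρ n => (C ρ n).M₂)

/-- The GSDoF region: all non-negative achievable pairs. -/
def gsdofRegion (ν : Measure State) (α : ℝ) (A : Schedule) : Set (ℝ × ℝ) :=
  {d | 0 ≤ d.1 ∧ 0 ≤ d.2 ∧ Achievable ν α A d}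

end MisoBC

end

/-! Divergences take the place of differential entropies. Write D(V|U) for `condKL P U V r`, where
the reference law `r` gives each state its own law and each output the circular Gaussian law whose
variance is the power gain of its link. For outputs, up to bounded terms per letter, D(V|U) is log ρ
times the sum of the link exponents minus the conditional entropy of V given U. It lives in [0,∞],
grows with conditioning, obeys a chain rule, and I(W;V) = D(V|W) - D(V). An output over a link of
exponent a has D at most a log ρ + O(1) (`condKL_rx_le`).

The heart is the single-letter inequality `two_mul_condKL_le`. The input at time t does not depend
on the current state, so a fresh independent copy of state and noise produces an output Y' with the
same conditional law given the past as Y. Two copies carry at least 2 D(Y|past). The two channel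
vectors are almost surely linearly independent, so Y and Y' together predict the other receiver's
output Z up to noise, which forces D(Z|past,Y,Y') ≥ min(a,b) log ρ - O(1). Expanding D of (Y,Y',Z)
in the other order yields 2 D(Y) + min(a,b) log ρ ≤ D(Y,Z) + a log ρ. The prediction coefficients
blow up near singular pairs, so they are bounded only on an event of probability 1-ε, at a loss of ε
log ρ.

For a block, let Y and Z be all outputs with the states adjoined, and let a, b and min stand for
their sums over time in units of log ρ. On one side, 2 I(W₁;Y) ≤ 2 D(Y|W₁) ≤ D(Y,Z|W₁) + a - min ≤
D(Z|W₁) + 2a - min. Secrecy makes D(Z|W₁) close to D(Z) ≤ D(Z|W₂) - I(W₂;Z). On the other side,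
I(W₁;Y) ≤ D(Y,Z|W₁,W₂) - D(Y,Z|W₂). Here D(Y,Z|W₁,W₂) ≤ D(Z|W₁,W₂) + a, secrecy and decodability of
W₂ make D(Z|W₁,W₂) close to D(Z|W₂), and D(Y,Z|W₂) ≥ 2 D(Z|W₂) + min - b. In the sum D(Z|W₂)
cancels, and Fano's inequality bounds 3 log M₁ + log M₂ by the sum of 3a + b - 2 min(a,b) = 2a +
|a-b| (`combine_bounds`, `rate_bound`).

Averaging over the topology and letting n, then ρ, tend to infinity, with ε arbitrary, gives the
first inequality. The second comes from exchanging the receivers (`Transmission.swap`). -/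

namespace MisoBC

open ProbabilityTheory InformationTheory

/-! ### Conditional divergence from a fixed reference law: data processing and chain rules. -/

section ConditionalDivergence

variable {Ω 𝒰 𝒱 𝒲 𝒰' 𝒱' : Type*} [MeasurableSpace Ω] [MeasurableSpace 𝒰] [MeasurableSpace 𝒱]
  [MeasurableSpace 𝒲] [MeasurableSpace 𝒰'] [MeasurableSpace 𝒱']

/-- Conditional relative entropy of `V` given `U` with respect to a reference law `r`. -/
noncomputable def condKL (P : Measure Ω) (U : Ω → 𝒰) (V : Ω → 𝒱) (r : Measure 𝒱) : ℝ≥0∞ :=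
  klDiv (P.map fun ω => (U ω, V ω)) ((P.map U).prod r)

theorem klDiv_map_measurableEquiv (μ ν : Measure 𝒰) [IsFiniteMeasure μ] [IsFiniteMeasure ν]
    (e : 𝒰 ≃ᵐ 𝒱) : klDiv (μ.map e) (ν.map e) = klDiv μ ν := by
  refine le_antisymm (klDiv_map_le _ _ e.measurable) ?_
  have h := klDiv_map_le (μ.map e) (ν.map e) e.symm.measurable
  rwa [Measure.map_map e.symm.measurable e.measurable,
    Measure.map_map e.symm.measurable e.measurable, e.symm_comp_self, Measure.map_id,
    Measure.map_id] at h

/-- Chain rule for the divergence from a product measure. -/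
theorem klDiv_prod_right [StandardBorelSpace 𝒱] [Nonempty 𝒱] (π : Measure (𝒰 × 𝒱))
    [IsProbabilityMeasure π] (μ : Measure 𝒰) [IsProbabilityMeasure μ] (q : Measure 𝒱)
    [IsProbabilityMeasure q] :
    klDiv π (μ.prod q) = klDiv π.fst μ + klDiv π (π.fst.prod q) := by
  -- A product law is the composition of its first marginal with a constant kernel, so this is the
  -- kernel chain rule. Disintegrating `π` is what needs a standard Borel second factor.
  have h := klDiv_compProd_eq_add π.fst μ π.condKernel (Kernel.const 𝒰 q)
  rwa [Measure.disintegrate, Measure.compProd_const, Measure.compProd_const] at h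

variable {P : Measure Ω} [IsProbabilityMeasure P] {U : Ω → 𝒰} {V : Ω → 𝒱} {W : Ω → 𝒲}
  {r : Measure 𝒱} [IsProbabilityMeasure r] {q : Measure 𝒲} [IsProbabilityMeasure q]

/-- Data processing. Coarsening the conditioning variable lowers the divergence: the counterpart of
"conditioning reduces entropy", with the sign reversed. -/
theorem condKL_comp_le (hU : Measurable U) (hV : Measurable V) {f : 𝒰 → 𝒰'} {g : 𝒱 → 𝒱'}
    (hf : Measurable f) (hg : Measurable g) :
    condKL P (fun ω => f (U ω)) (fun ω => g (V ω)) (r.map g) ≤ condKL P U V r := by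
  have := Measure.isProbabilityMeasure_map (μ := P) hU.aemeasurable
  have h := klDiv_map_le (P.map fun ω => (U ω, V ω)) ((P.map U).prod r) (hf.prodMap hg)
  rw [Measure.map_map (hf.prodMap hg) (hU.prodMk hV), ← Measure.map_prod_map _ _ hf hg,
    Measure.map_map hf hU] at h
  exact h

theorem condKL_comp_left_le (hU : Measurable U) (hV : Measurable V) {f : 𝒰 → 𝒰'}
    (hf : Measurable f) :
    condKL P (fun ω => f (U ω)) V r ≤ condKL P U V r := by
  simpa using condKL_comp_le (g := id) (r := r) (P := P) hU hV hf measurable_id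

theorem condKL_comp_right_le (hU : Measurable U) (hV : Measurable V) {g : 𝒱 → 𝒱'}
    (hg : Measurable g) {r' : Measure 𝒱'} (hr : r.map g = r') :
    condKL P U (fun ω => g (V ω)) r' ≤ condKL P U V r := by
  rw [← hr]
  exact condKL_comp_le (f := id) hU hV measurable_id hg

/-- The reference is a product, so the second term keeps the same reference `q` whatever the
conditioning. The same pair can therefore be expanded in either order. -/
theorem condKL_chain [StandardBorelSpace 𝒲] [Nonempty 𝒲] (hU : Measurable U) (hV : Measurable V)
    (hW : Measurable W) :
    condKL P U (fun ω => (V ω, W ω)) (r.prod q) =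
      condKL P U V r + condKL P (fun ω => (U ω, V ω)) W q := by
  have := Measure.isProbabilityMeasure_map (μ := P) hU.aemeasurable
  have := Measure.isProbabilityMeasure_map (μ := P) ((hU.prodMk hV).prodMk hW).aemeasurable
  have := Measure.isProbabilityMeasure_map (μ := P) (hU.prodMk (hV.prodMk hW)).aemeasurable
  have h := klDiv_prod_right (P.map fun ω => ((U ω, V ω), W ω)) ((P.map U).prod r) q
  rw [Measure.fst_map_prodMk hW] at h
  rw [condKL, condKL, condKL, ← h,
    ← klDiv_map_measurableEquiv _ _ (MeasurableEquiv.prodAssoc (α := 𝒰) (β := 𝒱) (γ := 𝒲)),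
    (measurePreserving_prodAssoc _ _ _).map_eq, Measure.map_map (MeasurableEquiv.measurable _)
    ((hU.prodMk hV).prodMk hW)]
  rfl

theorem condKL_eq_zero (h : P.map (fun ω => (U ω, V ω)) = (P.map U).prod r) :
    condKL P U V r = 0 := by
  rw [condKL, h, klDiv_self]

/-- Only the joint law matters, so the sample space may be enlarged by fresh randomness. -/
theorem condKL_congr {Ω' : Type*} [MeasurableSpace Ω'] {P' : Measure Ω'} {U' : Ω' → 𝒰}
    {V' : Ω' → 𝒱} (hV : Measurable V) (hV' : Measurable V')
    (h : P.map (fun ω => (U ω, V ω)) = P'.map (fun ω => (U' ω, V' ω))) :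
    condKL P U V r = condKL P' U' V' r := by
  have h' := congrArg Measure.fst h
  rw [Measure.fst_map_prodMk hV, Measure.fst_map_prodMk hV'] at h'
  rw [condKL, condKL, h, h']

/-- Decomposition of a divergence into the divergence of one marginal and a mutual information. -/
theorem condKL_prod_left [StandardBorelSpace 𝒲] [Nonempty 𝒲] (hU : Measurable U)
    (hV : Measurable V) (hW : Measurable W)
    (h : P.map (fun ω => (W ω, U ω)) = (P.map W).prod (P.map U)) :
    condKL P (fun ω => (W ω, U ω)) V r =
      condKL P U V r + klDiv (P.map fun ω => (W ω, (U ω, V ω)))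
        ((P.map W).prod (P.map fun ω => (U ω, V ω))) := by
  have := Measure.isProbabilityMeasure_map (μ := P) hU.aemeasurable
  have := Measure.isProbabilityMeasure_map (μ := P) hW.aemeasurable
  have := Measure.isProbabilityMeasure_map (μ := P) ((hU.prodMk hV)).aemeasurable
  have := Measure.isProbabilityMeasure_map (μ := P) ((hU.prodMk hV).prodMk hW).aemeasurable
  have := Measure.isProbabilityMeasure_map (μ := P) ((hW.prodMk hU).prodMk hV).aemeasurable
  have := Measure.isProbabilityMeasure_map (μ := P) (hW.prodMk (hU.prodMk hV)).aemeasurable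
  -- Independence of `W` and `U` turns the reference of the left-hand side into P_U × r × P_W.
  -- Splitting off the last factor leaves the divergence of (U,V) and the mutual information of `W`
  -- with (U,V).
  have e := klDiv_prod_right (P.map fun ω => ((U ω, V ω), W ω)) ((P.map U).prod r) (P.map W)
  rw [Measure.fst_map_prodMk hW] at e
  rw [condKL, condKL, h,
    ← klDiv_map_measurableEquiv (P.map fun ω => (W ω, (U ω, V ω))) _ MeasurableEquiv.prodComm,
    ← klDiv_map_measurableEquiv (P.map fun ω => ((W ω, U ω), V ω)) _
      (MeasurableEquiv.prodAssoc.trans MeasurableEquiv.prodComm),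
    Measure.map_map (MeasurableEquiv.measurable _) (hW.prodMk (hU.prodMk hV)),
    Measure.map_map (MeasurableEquiv.measurable _) ((hW.prodMk hU).prodMk hV)]
  have h1 : (((P.map W).prod (P.map U)).prod r).map
      (MeasurableEquiv.prodAssoc.trans MeasurableEquiv.prodComm) =
      ((P.map U).prod r).prod (P.map W) := by
    rw [MeasurableEquiv.coe_trans, ← Measure.map_map (MeasurableEquiv.measurable _)
      (MeasurableEquiv.measurable _), (measurePreserving_prodAssoc _ _ _).map_eq]
    exact Measure.prod_swap
  have h2 : ((P.map W).prod (P.map fun ω => (U ω, V ω))).map MeasurableEquiv.prodComm =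
      (P.map fun ω => (U ω, V ω)).prod (P.map W) := Measure.prod_swap
  rw [h1, h2]
  exact e

/-- Decomposition of a divergence into the divergence of the marginal and a mutual information. -/
theorem condKL_eq_klDiv_add [StandardBorelSpace 𝒲] [Nonempty 𝒲] (hV : Measurable V)
    (hW : Measurable W) :
    condKL P W V r = klDiv (P.map V) r + klDiv (P.map fun ω => (W ω, V ω))
        ((P.map W).prod (P.map V)) := by
  have := Measure.isProbabilityMeasure_map (μ := P) hV.aemeasurable
  have := Measure.isProbabilityMeasure_map (μ := P) hW.aemeasurable
  have := Measure.isProbabilityMeasure_map (μ := P) (hV.prodMk hW).aemeasurable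
  have := Measure.isProbabilityMeasure_map (μ := P) (hW.prodMk hV).aemeasurable
  have e := klDiv_prod_right (P.map fun ω => (V ω, W ω)) r (P.map W)
  rw [Measure.fst_map_prodMk hW] at e
  rw [condKL, ← klDiv_map_measurableEquiv (P.map fun ω => (W ω, V ω)) _ MeasurableEquiv.prodComm,
    ← klDiv_map_measurableEquiv (P.map fun ω => (W ω, V ω)) ((P.map W).prod (P.map V))
      MeasurableEquiv.prodComm,
    Measure.map_map (MeasurableEquiv.measurable _) (hW.prodMk hV)]
  have h1 : ((P.map W).prod r).map MeasurableEquiv.prodComm = r.prod (P.map W) := Measure.prod_swap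
  have h2 : ((P.map W).prod (P.map V)).map MeasurableEquiv.prodComm = (P.map V).prod (P.map W) :=
    Measure.prod_swap
  rw [h1, h2]
  exact e

end ConditionalDivergence

/-! ### Variational bound and explicit formula for the divergence. -/

section Gibbs

variable {α : Type*} [MeasurableSpace α]

/-- Variational lower bound for the divergence. -/
theorem ofReal_integral_le_klDiv (P Q : Measure α) [IsProbabilityMeasure P]
    [IsProbabilityMeasure Q] {f : α → ℝ} (hf : Integrable f P) (hm : Measurable f)
    (h1 : ∫⁻ x, ENNReal.ofReal (Real.exp (f x)) ∂Q ≤ 1) :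
    ENNReal.ofReal (∫ x, f x ∂P) ≤ klDiv P Q := by
  by_cases htop : klDiv P Q = ∞
  · simp [htop]
  obtain ⟨hac, hint⟩ := klDiv_ne_top_iff.1 htop
  have hexp : Integrable (fun x => Real.exp (f x)) Q :=
    ⟨(Real.measurable_exp.comp hm).aestronglyMeasurable, by
      rw [hasFiniteIntegral_iff_ofReal (ae_of_all _ fun _ => (Real.exp_pos _).le)]
      exact h1.trans_lt ENNReal.one_lt_top⟩
  have hle : ∫ x, Real.exp (f x) ∂Q ≤ 1 := by
    rw [integral_eq_lintegral_of_nonneg_ae (ae_of_all _ fun _ => (Real.exp_pos _).le)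
      hexp.aestronglyMeasurable]
    exact ENNReal.toReal_le_of_le_ofReal zero_le_one (by simpa using h1)
  -- The divergence of `P` from `Q` tilted by `f` is nonnegative, and equals the divergence from `Q`
  -- minus ∫ f dP plus log ∫ exp f dQ. The last term is at most 0 by `h1`.
  have := isProbabilityMeasure_tilted hexp
  have key := integral_llr_tilted_right hac hf hexp hint
  have hac' : P ≪ Q.tilted f := hac.trans (absolutelyContinuous_tilted hexp)
  have hnn := integral_llr_add_sub_measure_univ_nonneg hac'
    (integrable_llr_tilted_right hac hf hint hexp)
  have hlog : Real.log (∫ x, Real.exp (f x) ∂Q) ≤ 0 :=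
    Real.log_nonpos (integral_exp_pos hexp).le hle
  rw [klDiv_of_ac_of_integrable hac hint]
  apply ENNReal.ofReal_le_ofReal
  simp only [probReal_univ] at hnn ⊢
  linarith

/-- The divergence of a law given by a log-density. -/
theorem klDiv_withDensity_exp (P Q : Measure α) [IsProbabilityMeasure P]
    [IsProbabilityMeasure Q] {f : α → ℝ} (hm : Measurable f)
    (hP : P = Q.withDensity fun x => ENNReal.ofReal (Real.exp (f x))) (hf : Integrable f P) :
    klDiv P Q = ENNReal.ofReal (∫ x, f x ∂P) := by
  have hac : P ≪ Q := hP ▸ withDensity_absolutelyContinuous _ _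
  have hme : Measurable fun x => ENNReal.ofReal (Real.exp (f x)) := by fun_prop
  have hllr : llr P Q =ᵐ[P] f := by
    refine hac.ae_le ?_
    have := Measure.rnDeriv_withDensity Q hme
    rw [← hP] at this
    filter_upwards [this] with x hx
    rw [llr, hx, ENNReal.toReal_ofReal (Real.exp_pos _).le, Real.log_exp]
  rw [klDiv_of_ac_of_integrable hac ((integrable_congr hllr).2 hf), integral_congr_ae hllr]
  simp

end Gibbs

/-! ### Uniform messages: Fano's inequality and the bound by log M. -/

section Uniform

variable {Ω 𝒰 𝒱 : Type*} [MeasurableSpace Ω] [MeasurableSpace 𝒰] [MeasurableSpace 𝒱]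
  {P : Measure Ω} [IsProbabilityMeasure P] {M : ℕ}

theorem uniformOn_univ_singleton (w : Fin M) :
    (uniformOn (Set.univ : Set (Fin M))) {w} = (M : ℝ≥0∞)⁻¹ := by
  have : Nonempty (Fin M) := ⟨w⟩
  rw [uniformOn_univ]
  simp

/-- A form of Fano's inequality: a uniform message that can be decoded from an observation has
large mutual information with the observation. -/
theorem fano_le (hM : 0 < M) {W : Ω → Fin M} {V : Ω → 𝒱} (hW : Measurable W) (hV : Measurable V)
    (hlaw : P.map W = uniformOn Set.univ) {dec : 𝒱 → Fin M} (hdec : Measurable dec) :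
    ENNReal.ofReal ((1 - P.real {ω | dec (V ω) ≠ W ω}) * Real.log M - Real.log 2) ≤
      klDiv (P.map fun ω => (W ω, V ω)) ((P.map W).prod (P.map V)) := by
  have := Measure.isProbabilityMeasure_map (μ := P) hW.aemeasurable
  have := Measure.isProbabilityMeasure_map (μ := P) hV.aemeasurable
  have := Measure.isProbabilityMeasure_map (μ := P) (hW.prodMk hV).aemeasurable
  have hM' : (0 : ℝ) < M := by exact_mod_cast hM
  set E : Set (Fin M × 𝒱) := {x | dec x.2 ≠ x.1} with hE
  have hEm : MeasurableSet E :=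
    (measurableSet_eq_fun (hdec.comp measurable_snd) measurable_fst).compl
  -- The test function is log(M/2) on correct decoding and -log 2 on errors. Under the product law
  -- the decoder is right with probability 1/M, so the exponential integrates to at most 1/2 +
  -- (M/2)(1/M) = 1.
  set f : Fin M × 𝒱 → ℝ := fun x => Real.log M - Real.log 2 - E.indicator (fun _ => Real.log M) x
  have hfm : Measurable f := measurable_const.sub (measurable_const.indicator hEm)
  have hi : Integrable (E.indicator fun _ => Real.log M) (P.map fun ω => (W ω, V ω)) :=
    (integrable_const _).indicator hEm
  have hfi : Integrable f (P.map fun ω => (W ω, V ω)) := (integrable_const _).sub hi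
  have key := ofReal_integral_le_klDiv (P.map fun ω => (W ω, V ω))
    ((P.map W).prod (P.map V)) hfi hfm ?_
  · refine le_trans (ENNReal.ofReal_le_ofReal ?_) key
    rw [integral_sub (integrable_const _) hi, integral_indicator hEm]
    have : (P.map fun ω => (W ω, V ω)).real E = P.real {ω | dec (V ω) ≠ W ω} := by
      rw [Measure.real, Measure.map_apply (hW.prodMk hV) hEm]; rfl
    simp only [integral_const, smul_eq_mul, probReal_univ, measureReal_restrict_apply_univ, this]
    linarith
  · have hb : ∀ x, ENNReal.ofReal (Real.exp (f x)) ≤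
        2⁻¹ + Eᶜ.indicator (fun _ => (M : ℝ≥0∞) / 2) x := by
      intro x
      by_cases hx : x ∈ E
      · have : Real.exp (f x) = 2⁻¹ := by
          simp only [f, Set.indicator_of_mem hx]
          rw [show Real.log M - Real.log 2 - Real.log M = -Real.log 2 by ring, Real.exp_neg,
            Real.exp_log two_pos]
        rw [this, Set.indicator_of_notMem (by simpa using hx), add_zero,
          ENNReal.ofReal_inv_of_pos two_pos]
        simp
      · have : Real.exp (f x) = M / 2 := by
          simp only [f, Set.indicator_of_notMem hx]
          rw [sub_zero, Real.exp_sub, Real.exp_log hM', Real.exp_log two_pos]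
        rw [this, Set.indicator_of_mem (by simpa using hx), ENNReal.ofReal_div_of_pos two_pos]
        simp
    refine (lintegral_mono hb).trans ?_
    rw [lintegral_add_left measurable_const, lintegral_const, lintegral_indicator hEm.compl,
      lintegral_const, Measure.restrict_apply_univ]
    have hq : ((P.map W).prod (P.map V)) Eᶜ = (M : ℝ≥0∞)⁻¹ := by
      rw [Measure.prod_apply_symm hEm.compl]
      have : ∀ y, (P.map W) ((fun x => (x, y)) ⁻¹' Eᶜ) = (M : ℝ≥0∞)⁻¹ := by
        intro y
        have : (fun x => (x, y)) ⁻¹' Eᶜ = {dec y} := by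
          ext x; simp [E, eq_comm]
        rw [this, hlaw, uniformOn_univ_singleton]
      rw [lintegral_congr this, lintegral_const, measure_univ, mul_one]
    rw [hq, ENNReal.div_eq_inv_mul, mul_assoc, ENNReal.mul_inv_cancel
      (by simpa using hM.ne') (by simp)]
    simp [ENNReal.inv_two_add_inv_two]

/-- Relative to the uniform law on `M` points, a conditional law has divergence at most `log M`. -/
theorem condKL_uniformOn_le (hM : 0 < M) {W : Ω → Fin M} {V : Ω → 𝒱} (hW : Measurable W)
    (hV : Measurable V) :
    condKL P V W (uniformOn Set.univ) ≤ ENNReal.ofReal (Real.log M) := by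
  have : Nonempty (Fin M) := ⟨⟨0, hM⟩⟩
  have := Measure.isProbabilityMeasure_map (μ := P) hV.aemeasurable
  have := Measure.isProbabilityMeasure_map (μ := P) (hV.prodMk hW).aemeasurable
  set π := P.map fun ω => (V ω, W ω)
  set Q := (P.map V).prod (uniformOn (Set.univ : Set (Fin M)))
  -- Each atom of the uniform law has mass 1/M, so the joint law has density at most M relative to
  -- the product. Its logarithm is then at most log M.
  have hbound : ∀ s, MeasurableSet s → π s ≤ (M : ℝ≥0∞) * Q s := by
    intro s hs
    have h1 : π s ≤ ∑ w, P.map V ((fun v => (v, w)) ⁻¹' s) := by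
      rw [Measure.map_apply (hV.prodMk hW) hs]
      refine (measure_mono (t := ⋃ w ∈ (Finset.univ : Finset (Fin M)), V ⁻¹' ((fun v => (v, w)) ⁻¹' s))
        fun ω hω => ?_).trans ((measure_biUnion_finset_le _ _).trans
        (Finset.sum_le_sum fun w _ => ?_))
      · simp only [Finset.mem_univ, Set.iUnion_true, Set.mem_iUnion]
        exact ⟨W ω, hω⟩
      · rw [Measure.map_apply hV (measurable_prodMk_right hs)]
    refine h1.trans_eq ?_
    rw [Measure.prod_apply_symm hs, lintegral_fintype]
    simp only [uniformOn_univ_singleton]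
    rw [← Finset.sum_mul, mul_comm, mul_assoc, ENNReal.inv_mul_cancel
      (by simpa using hM.ne') (by simp), mul_one]
  have hac : π ≪ Q := Measure.AbsolutelyContinuous.mk fun s hs h0 => by
    simpa [h0] using hbound s hs
  have hd : ∀ᵐ x ∂Q, π.rnDeriv Q x ≤ M := by
    refine ae_le_of_forall_setLIntegral_le_of_sigmaFinite (Measure.measurable_rnDeriv _ _)
      fun s hs _ => ?_
    rw [setLIntegral_const]
    exact (Measure.setLIntegral_rnDeriv_le s).trans (hbound s hs)
  have hd' : ∀ᵐ x ∂Q, (π.rnDeriv Q x).toReal ≤ M := by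
    filter_upwards [hd] with x hx
    simpa using ENNReal.toReal_mono (by simp) hx
  have hint : Integrable (llr π Q) π := by
    -- The logarithm is unbounded below near density 0, but `klFun` is continuous and hence bounded
    -- on [0,M].
    rw [← integrable_klFun_rnDeriv_iff hac]
    obtain ⟨c, hc⟩ := (isCompact_Icc (a := (0 : ℝ)) (b := M)).exists_bound_of_continuousOn
      continuous_klFun.continuousOn
    refine Integrable.of_bound (C := c) (measurable_klFun.comp
      (Measure.measurable_rnDeriv _ _).ennreal_toReal).aestronglyMeasurable ?_
    filter_upwards [hd'] with x hx
    exact hc _ ⟨ENNReal.toReal_nonneg, hx⟩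
  rw [condKL, klDiv_of_ac_of_integrable hac hint]
  apply ENNReal.ofReal_le_ofReal
  have hmono : ∫ x, llr π Q x ∂π ≤ ∫ _, Real.log M ∂π := by
    refine integral_mono_ae hint (integrable_const _) ?_
    filter_upwards [hac.ae_le hd', Measure.rnDeriv_pos hac, hac.ae_le (Measure.rnDeriv_lt_top π Q)]
      with x hx h0 htop
    have hx' := ENNReal.toReal_pos h0.ne' htop.ne
    exact Real.log_le_log hx' hx
  simp only [probReal_univ, integral_const, smul_eq_mul, one_mul] at hmono ⊢
  linarith

end Uniform

/-! ### Chain rule along time for product reference laws. -/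

section TimeChain

variable {Ω 𝒰 E : Type*} [MeasurableSpace Ω] [MeasurableSpace 𝒰] [MeasurableSpace E]
  {P : Measure Ω} [IsProbabilityMeasure P]

/-- The entries of a sequence strictly before time `t`. -/
def pre {E : Type*} {n : ℕ} (t : Fin n) (x : Fin n → E) : Fin (t : ℕ) → E :=
  fun k => x (Fin.castLE t.isLt.le k)

theorem measurable_pre {n : ℕ} (t : Fin n) : Measurable (pre (E := E) t) :=
  measurable_pi_lambda _ fun _ => measurable_pi_apply _

theorem measurePreserving_init_last {n : ℕ} (κ : Fin (n + 1) → Measure E)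
    [∀ i, IsProbabilityMeasure (κ i)] :
    MeasurePreserving (fun x : Fin (n + 1) → E => ((fun k : Fin n => x k.castSucc), x (Fin.last n)))
      (Measure.pi κ) ((Measure.pi fun k : Fin n => κ k.castSucc).prod (κ (Fin.last n))) := by
  have h := (measurePreserving_piFinSuccAbove κ (Fin.last n))
  have h2 := (Measure.measurePreserving_swap (μ := κ (Fin.last n))
    (ν := Measure.pi fun j : Fin n => κ ((Fin.last n).succAbove j))).comp h
  simp only [Fin.succAbove_last] at h2
  convert h2 using 1
  funext x
  simp [MeasurableEquiv.piFinSuccAbove, Fin.init_def]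

theorem measurePreserving_init_last_symm {n : ℕ} (κ : Fin (n + 1) → Measure E)
    [∀ i, IsProbabilityMeasure (κ i)] :
    MeasurePreserving (fun y : (Fin n → E) × E => (Fin.snoc y.1 y.2 : Fin (n + 1) → E))
      ((Measure.pi fun k : Fin n => κ k.castSucc).prod (κ (Fin.last n))) (Measure.pi κ) := by
  have hm : Measurable (fun y : (Fin n → E) × E => (Fin.snoc y.1 y.2 : Fin (n + 1) → E)) := by
    refine measurable_pi_lambda _ fun i => ?_
    refine Fin.lastCases ?_ (fun i => ?_) i
    · simpa using measurable_snd
    · simp only [Fin.snoc_castSucc]; fun_prop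
  refine ⟨hm, ?_⟩
  rw [← (measurePreserving_init_last κ).map_eq,
    Measure.map_map hm (measurePreserving_init_last κ).measurable]
  convert Measure.map_id
  funext x
  exact Fin.snoc_init_self x

/-- Last step of the chain rule in time. -/
theorem condKL_pi_succ [StandardBorelSpace E] [Nonempty E] {n : ℕ} {U : Ω → 𝒰}
    {D : Ω → Fin (n + 1) → E}
    (hU : Measurable U) (hD : Measurable D) (κ : Fin (n + 1) → Measure E)
    [∀ i, IsProbabilityMeasure (κ i)] :
    condKL P U D (Measure.pi κ) =
      condKL P U (fun ω (k : Fin n) => D ω k.castSucc) (Measure.pi fun k : Fin n => κ k.castSucc) +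
      condKL P (fun ω => (U ω, fun (k : Fin n) => D ω k.castSucc)) (fun ω => D ω (Fin.last n))
        (κ (Fin.last n)) := by
  have h1 : Measurable fun ω => (fun (k : Fin n) => D ω k.castSucc) := by fun_prop
  have h2 : Measurable fun ω => D ω (Fin.last n) := by fun_prop
  rw [← condKL_chain hU h1 h2]
  refine le_antisymm ?_ ?_
  · have := condKL_comp_right_le (P := P) hU (h1.prodMk h2)
      (measurePreserving_init_last_symm κ).measurable (measurePreserving_init_last_symm κ).map_eq
    have hs : ∀ ω, (Fin.snoc (fun k : Fin n => D ω k.castSucc) (D ω (Fin.last n)) :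
      Fin (n + 1) → E) = D ω := fun ω => Fin.snoc_init_self (D ω)
    simpa only [hs] using this
  · exact condKL_comp_right_le (P := P) hU hD
      (measurePreserving_init_last κ).measurable (measurePreserving_init_last κ).map_eq

/-- Chain rule in time. -/
theorem condKL_pi [StandardBorelSpace E] [Nonempty E] {n : ℕ} {U : Ω → 𝒰} {D : Ω → Fin n → E}
    (hU : Measurable U) (hD : Measurable D) (κ : Fin n → Measure E)
    [∀ i, IsProbabilityMeasure (κ i)] :
    condKL P U D (Measure.pi κ) =
      ∑ t, condKL P (fun ω => (U ω, pre t (D ω))) (fun ω => D ω t) (κ t) := by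
  induction n with
  | zero =>
    rw [Finset.univ_eq_empty, Finset.sum_empty]
    have hD' : D = fun _ => default := funext fun _ => Subsingleton.elim _ _
    have hp : Measure.pi κ = Measure.dirac default := Measure.pi_of_empty κ default
    apply condKL_eq_zero
    rw [hp, Measure.prod_dirac, Measure.map_map (by fun_prop) hU, hD']
    rfl
  | succ n ih =>
    rw [condKL_pi_succ hU hD, Fin.sum_univ_castSucc, ih (by fun_prop)]
    rfl

/-- Under a product law the entry at time `t` is independent of the earlier ones. -/
theorem measurePreserving_pre {n : ℕ} (τ : Measure E) [IsProbabilityMeasure τ] (t : Fin n) :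
    MeasurePreserving (fun x : Fin n → E => (pre t x, x t)) (Measure.pi fun _ => τ)
      ((Measure.pi fun _ => τ).prod τ) := by
  induction n with
  | zero => exact t.elim0
  | succ n ih =>
    refine Fin.lastCases ?_ (fun t => ?_) t
    · exact measurePreserving_init_last fun _ => τ
    · exact (ih t).comp (measurePreserving_fst.comp (measurePreserving_init_last fun _ => τ))

end TimeChain

/-! ### Circular complex Gaussian laws and shifted Gaussian outputs. -/

section Gaussian

/-- Log-density of the circularly symmetric complex Gaussian law of variance `v`. -/
noncomputable def logGauss (v : ℝ) (z : ℂ) : ℝ := -Real.log (Real.pi * v) - ‖z‖ ^ 2 / v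

/-- The circularly symmetric complex Gaussian law of variance `v`. -/
noncomputable def cgauss (v : ℝ) : Measure ℂ :=
  volume.withDensity fun z => ENNReal.ofReal (Real.exp (logGauss v z))

theorem measurable_logGauss (v : ℝ) : Measurable (logGauss v) := by
  unfold logGauss; fun_prop

theorem measurable_expLogGauss (v : ℝ) :
    Measurable fun z => ENNReal.ofReal (Real.exp (logGauss v z)) := by
  have := measurable_logGauss v
  fun_prop

theorem exp_logGauss {v : ℝ} (hv : 0 < v) (z : ℂ) :
    Real.exp (logGauss v z) = (Real.pi * v)⁻¹ * Real.exp (-v⁻¹ * ‖z‖ ^ 2) := by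
  rw [logGauss, sub_eq_add_neg, Real.exp_add, Real.exp_neg, Real.exp_log (by positivity)]
  congr 2
  ring

theorem lintegral_exp_logGauss {v : ℝ} (hv : 0 < v) :
    ∫⁻ z, ENNReal.ofReal (Real.exp (logGauss v z)) = 1 := by
  have h := GaussianFourier.integral_rexp_neg_mul_sq_norm (V := ℂ) (inv_pos.2 hv)
  rw [Complex.finrank_real_complex] at h
  have h' : ∫ z : ℂ, Real.exp (-v⁻¹ * ‖z‖ ^ 2) = Real.pi * v := by simpa using h
  -- A non-integrable function has integral 0 by convention, while the known value π v is positive.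
  have hi : Integrable fun z : ℂ => Real.exp (-v⁻¹ * ‖z‖ ^ 2) := by
    by_contra hc
    rw [integral_undef hc] at h'
    exact (mul_pos Real.pi_pos hv).ne h'
  rw [← ofReal_integral_eq_lintegral_ofReal _ (ae_of_all _ fun _ => (Real.exp_pos _).le)]
  · simp_rw [exp_logGauss hv]
    rw [integral_const_mul, h', inv_mul_cancel₀ (by positivity), ENNReal.ofReal_one]
  · simp_rw [exp_logGauss hv]
    exact hi.const_mul _

theorem isProbabilityMeasure_cgauss {v : ℝ} (hv : 0 < v) : IsProbabilityMeasure (cgauss v) :=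
  ⟨by rw [cgauss, withDensity_apply _ .univ, Measure.restrict_univ, lintegral_exp_logGauss hv]⟩

theorem gaussianPDF_mul_gaussianPDF (x y : ℝ) :
    gaussianPDF 0 (1 / 2) x * gaussianPDF 0 (1 / 2) y =
      ENNReal.ofReal (Real.exp (logGauss 1 ⟨x, y⟩)) := by
  rw [gaussianPDF, gaussianPDF, ← ENNReal.ofReal_mul (gaussianPDFReal_nonneg _ _ _),
    exp_logGauss one_pos, gaussianPDFReal, gaussianPDFReal]
  congr 1
  have h : (2 * Real.pi * ((1 / 2 : ℝ≥0) : ℝ)) = Real.pi := by push_cast; ring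
  have hn : ‖(⟨x, y⟩ : ℂ)‖ ^ 2 = x ^ 2 + y ^ 2 := by
    rw [Complex.sq_norm, Complex.normSq_mk]; ring
  rw [h, hn, mul_mul_mul_comm, ← Real.exp_add, ← mul_inv, Real.mul_self_sqrt Real.pi_pos.le, mul_one]
  congr 2
  push_cast
  ring

theorem stdComplexGaussian_eq : stdComplexGaussian = cgauss 1 := by
  have h2 : (1 / 2 : ℝ≥0) ≠ 0 := by simp
  rw [stdComplexGaussian, gaussianReal_of_var_ne_zero _ h2,
    prod_withDensity (measurable_gaussianPDF _ _) (measurable_gaussianPDF _ _)]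
  ext s hs
  have hp := Complex.volume_preserving_equiv_real_prod.symm
  rw [Measure.map_apply (MeasurableEquiv.measurable _) hs,
    withDensity_apply _ (MeasurableEquiv.measurable _ hs), cgauss, withDensity_apply _ hs,
    ← hp.setLIntegral_comp_preimage hs (measurable_expLogGauss 1)]
  simp_rw [gaussianPDF_mul_gaussianPDF]
  rfl

instance : IsProbabilityMeasure stdComplexGaussian :=
  stdComplexGaussian_eq ▸ isProbabilityMeasure_cgauss one_pos

theorem integrable_sq_stdComplexGaussian :
    Integrable (fun z : ℂ => ‖z‖ ^ 2) stdComplexGaussian := by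
  have hm := memLp_id_gaussianReal (μ := 0) (v := 1 / 2) 2
  have hi : Integrable (fun x : ℝ => x ^ 2) (gaussianReal 0 (1 / 2)) := by
    simpa using hm.integrable_sq
  rw [stdComplexGaussian, integrable_map_equiv]
  have := (hi.comp_fst (gaussianReal 0 (1 / 2))).add (hi.comp_snd (gaussianReal 0 (1 / 2)))
  refine this.congr (ae_of_all _ fun p => ?_)
  change p.1 ^ 2 + p.2 ^ 2 = ‖(⟨p.1, p.2⟩ : ℂ)‖ ^ 2
  rw [Complex.sq_norm, Complex.normSq_mk]
  ring

/-- The integrand is the likelihood ratio of the Gaussian of variance `τ` centred at `m` against the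
reference. This normalization makes its logarithm an admissible test function in
`ofReal_integral_le_klDiv`. -/
theorem lintegral_exp_logGauss_sub {v τ : ℝ} (hτ : 0 < τ) (m : ℂ) :
    ∫⁻ z, ENNReal.ofReal (Real.exp (logGauss τ (z - m) - logGauss v z)) ∂cgauss v = 1 := by
  have h1 := measurable_logGauss v
  have h2 := measurable_logGauss τ
  rw [cgauss, lintegral_withDensity_eq_lintegral_mul _ (measurable_expLogGauss v) (by fun_prop)]
  simp only [Pi.mul_apply, ← ENNReal.ofReal_mul (Real.exp_pos _).le, ← Real.exp_add,
    add_sub_cancel]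
  rw [lintegral_sub_right_eq_self fun z => ENNReal.ofReal (Real.exp (logGauss τ z))]
  exact lintegral_exp_logGauss hτ

variable {Ω 𝒰 : Type*} [MeasurableSpace Ω] [MeasurableSpace 𝒰]
  {P : Measure Ω} [IsProbabilityMeasure P]

/-- Given `U`, the output is Gaussian of variance 1 centred at `m U`, so the density is a ratio of
two Gaussian densities. Its explicit logarithm makes `klDiv_withDensity_exp` applicable. -/
theorem map_shift_eq_withDensity {U : Ω → 𝒰} {N : Ω → ℂ} (hU : Measurable U) (hN : Measurable N)
    (h : P.map (fun ω => (U ω, N ω)) = (P.map U).prod stdComplexGaussian) {m : 𝒰 → ℂ}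
    (hm : Measurable m) {v : ℝ} (hv : 0 < v) :
    P.map (fun ω => (U ω, m (U ω) + N ω)) = ((P.map U).prod (cgauss v)).withDensity
      fun x => ENNReal.ofReal (Real.exp (logGauss 1 (x.2 - m x.1) - logGauss v x.2)) := by
  have := isProbabilityMeasure_cgauss hv
  have h1 := measurable_logGauss 1
  have h2 := measurable_logGauss v
  have h3 := measurable_expLogGauss v
  have hsh : Measurable fun x : 𝒰 × ℂ => (x.1, m x.1 + x.2) := by fun_prop
  have e : P.map (fun ω => (U ω, m (U ω) + N ω)) =
      ((P.map U).prod stdComplexGaussian).map fun x => (x.1, m x.1 + x.2) := by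
    rw [← h, Measure.map_map hsh (hU.prodMk hN)]; rfl
  rw [e]
  ext s hs
  have hf : Measurable fun x : 𝒰 × ℂ =>
      ENNReal.ofReal (Real.exp (logGauss 1 (x.2 - m x.1) - logGauss v x.2)) := by fun_prop
  rw [Measure.map_apply hsh hs, withDensity_apply _ hs, ← lintegral_indicator hs,
    lintegral_prod _ (hf.indicator hs).aemeasurable, Measure.prod_apply (hsh hs)]
  refine lintegral_congr fun u => ?_
  have hsu : MeasurableSet (Prod.mk u ⁻¹' s) := measurable_prodMk_left hs
  have hw := lintegral_withDensity_eq_lintegral_mul volume h3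
    ((hf.indicator hs).comp (measurable_prodMk_left (x := u)))
  simp only [Function.comp_apply] at hw
  rw [cgauss, hw, stdComplexGaussian_eq, cgauss,
    withDensity_apply _ (measurable_prodMk_left (hsh hs)),
    ← lintegral_indicator (measurable_prodMk_left (hsh hs)),
    ← lintegral_sub_right_eq_self _ (m u)]
  refine lintegral_congr fun z => ?_
  by_cases hz : (u, z) ∈ s
  · rw [Set.indicator_of_mem (by simpa using hz), Pi.mul_apply, Function.comp_apply,
      Set.indicator_of_mem hz, ← ENNReal.ofReal_mul (Real.exp_pos _).le, ← Real.exp_add, add_sub_cancel]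
  · rw [Set.indicator_of_notMem (by simpa using hz), Pi.mul_apply, Function.comp_apply,
      Set.indicator_of_notMem hz, mul_zero]

/-- Adding independent Gaussian noise limits the divergence from a Gaussian law of larger
variance. -/
theorem condKL_shift_le {U : Ω → 𝒰} {N Y : Ω → ℂ} (hU : Measurable U) (hN : Measurable N)
    (h : P.map (fun ω => (U ω, N ω)) = (P.map U).prod stdComplexGaussian) {m : 𝒰 → ℂ}
    (hm : Measurable m) (hY : ∀ ω, Y ω = m (U ω) + N ω) {v κ : ℝ} (hv : 0 < v)
    (hi : Integrable (fun ω => ‖Y ω‖ ^ 2) P) (hκ : ∫ ω, ‖Y ω‖ ^ 2 ∂P ≤ κ * v) :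
    condKL P U Y (cgauss v) ≤ ENNReal.ofReal (Real.log v + κ) := by
  obtain rfl : Y = fun ω => m (U ω) + N ω := funext hY
  have := isProbabilityMeasure_cgauss hv
  have := Measure.isProbabilityMeasure_map (μ := P) hU.aemeasurable
  have hYm : Measurable fun ω => (U ω, m (U ω) + N ω) := by fun_prop
  have := Measure.isProbabilityMeasure_map (μ := P) hYm.aemeasurable
  have h1 := measurable_logGauss 1
  have h2 := measurable_logGauss v
  have hfm : Measurable fun x : 𝒰 × ℂ => logGauss 1 (x.2 - m x.1) - logGauss v x.2 := by fun_prop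
  have hlN : P.map N = stdComplexGaussian := by
    have := congrArg Measure.snd h
    rwa [Measure.snd_map_prodMk hU, Measure.snd_prod] at this
  have hiN : Integrable (fun ω => ‖N ω‖ ^ 2) P := by
    have := integrable_sq_stdComplexGaussian
    rw [← hlN] at this
    exact this.comp_measurable hN
  have hval : ∀ ω, logGauss 1 (m (U ω) + N ω - m (U ω)) - logGauss v (m (U ω) + N ω) =
      Real.log v - ‖N ω‖ ^ 2 + ‖m (U ω) + N ω‖ ^ 2 / v := by
    intro ω
    rw [logGauss, logGauss, Real.log_mul Real.pi_pos.ne' hv.ne', add_sub_cancel_left]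
    simp only [mul_one, div_one]
    ring
  have hfi : Integrable (fun x : 𝒰 × ℂ => logGauss 1 (x.2 - m x.1) - logGauss v x.2)
      (P.map fun ω => (U ω, m (U ω) + N ω)) := by
    rw [integrable_map_measure hfm.aestronglyMeasurable hYm.aemeasurable]
    simp only [Function.comp_def, hval]
    exact ((integrable_const _).sub hiN).add (hi.div_const v)
  rw [condKL, klDiv_withDensity_exp _ _ hfm (map_shift_eq_withDensity hU hN h hm hv) hfi]
  apply ENNReal.ofReal_le_ofReal
  rw [integral_map hYm.aemeasurable hfm.aestronglyMeasurable]
  simp only [hval]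
  have hsum : ∫ ω, (Real.log v - ‖N ω‖ ^ 2 + ‖m (U ω) + N ω‖ ^ 2 / v) ∂P =
      Real.log v - ∫ ω, ‖N ω‖ ^ 2 ∂P + (∫ ω, ‖m (U ω) + N ω‖ ^ 2 ∂P) / v := by
    rw [integral_add (f := fun ω => Real.log v - ‖N ω‖ ^ 2)
      ((integrable_const _).sub hiN) (hi.div_const v), integral_sub (integrable_const _) hiN,
      integral_div]
    simp
  rw [hsum]
  -- The divergence equals log v - E|N|² + E|Y|²/v. The noise term has the favourable sign and is
  -- dropped.
  have hn : 0 ≤ ∫ ω, ‖N ω‖ ^ 2 ∂P := integral_nonneg fun _ => by positivity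
  have hd : (∫ ω, ‖m (U ω) + N ω‖ ^ 2 ∂P) / v ≤ κ := (div_le_iff₀ hv).2 hκ
  linarith

end Gaussian

/-! ### Received signals and their power. -/

section Received

/-- Received signal with amplitude gain `r`, channel vector `p`, channel input `x`, noise `n`. -/
noncomputable def rx (r : ℝ) (p x : Vec) (n : ℂ) : ℂ := (r : ℂ) * ∑ i, p i * x i + n

@[fun_prop]
theorem measurable_rx {α : Type*} [MeasurableSpace α] {p x : α → Vec} {n : α → ℂ} {r : ℝ}
    (hp : Measurable p) (hx : Measurable x) (hn : Measurable n) :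
    Measurable fun a => rx r (p a) (x a) (n a) := by
  unfold rx
  exact (measurable_const.mul (Finset.measurable_sum _ fun i _ =>
    ((measurable_pi_apply i).comp hp).mul ((measurable_pi_apply i).comp hx))).add hn

theorem norm_add_sq_le_two (a b : ℂ) : ‖a + b‖ ^ 2 ≤ 2 * ‖a‖ ^ 2 + 2 * ‖b‖ ^ 2 := by
  have h := norm_add_le a b
  nlinarith [norm_nonneg a, norm_nonneg b, norm_nonneg (a + b), sq_nonneg (‖a‖ - ‖b‖)]

theorem norm_rx_sq_le {r : ℝ} {p x : Vec} {n : ℂ} (hx : ∑ i, ‖x i‖ ^ 2 ≤ 1) :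
    ‖rx r p x n‖ ^ 2 ≤ 2 * r ^ 2 * ∑ i, ‖p i‖ ^ 2 + 2 * ‖n‖ ^ 2 := by
  refine (norm_add_sq_le_two _ _).trans (add_le_add ?_ le_rfl)
  have hcs : ‖∑ i, p i * x i‖ ^ 2 ≤ ∑ i, ‖p i‖ ^ 2 := by
    have h1 : ‖∑ i, p i * x i‖ ≤ ∑ i, ‖p i‖ * ‖x i‖ :=
      (norm_sum_le _ _).trans (Finset.sum_le_sum fun i _ => (norm_mul _ _).le)
    calc ‖∑ i, p i * x i‖ ^ 2 ≤ (∑ i, ‖p i‖ * ‖x i‖) ^ 2 := by gcongr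
      _ ≤ (∑ i, ‖p i‖ ^ 2) * ∑ i, ‖x i‖ ^ 2 := Finset.sum_mul_sq_le_sq_mul_sq _ _ _
      _ ≤ (∑ i, ‖p i‖ ^ 2) * 1 := by gcongr
      _ = _ := mul_one _
  rw [norm_mul, mul_pow, Complex.norm_real, Real.norm_eq_abs, sq_abs, mul_assoc]
  gcongr

/-- Second moment of the receiver noise. -/
noncomputable def noisePower : ℝ := ∫ z, ‖z‖ ^ 2 ∂stdComplexGaussian

theorem noisePower_nonneg : 0 ≤ noisePower := integral_nonneg fun _ => by positivity

variable {Ω 𝒰 : Type*} [MeasurableSpace Ω] [MeasurableSpace 𝒰]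
  {P : Measure Ω} [IsProbabilityMeasure P]

theorem integrable_norm_sq_of_law {N : Ω → ℂ} (hN : Measurable N)
    (h : P.map N = stdComplexGaussian) : Integrable (fun ω => ‖N ω‖ ^ 2) P := by
  have := integrable_sq_stdComplexGaussian
  rw [← h] at this
  exact this.comp_measurable hN

theorem integral_norm_sq_of_law {N : Ω → ℂ} (hN : Measurable N)
    (h : P.map N = stdComplexGaussian) : ∫ ω, ‖N ω‖ ^ 2 ∂P = noisePower := by
  rw [noisePower, ← h, integral_map hN.aemeasurable (by fun_prop)]

theorem integrable_norm_rx_sq {p x : Ω → Vec} {N : Ω → ℂ} (r : ℝ) (hp : Measurable p)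
    (hx : Measurable x) (hN : Measurable N) (hpow : ∀ ω, ∑ i, ‖x ω i‖ ^ 2 ≤ 1)
    (hip : Integrable (fun ω => ∑ i, ‖p ω i‖ ^ 2) P) (h : P.map N = stdComplexGaussian) :
    Integrable (fun ω => ‖rx r (p ω) (x ω) (N ω)‖ ^ 2) P :=
  ((hip.const_mul (2 * r ^ 2)).add ((integrable_norm_sq_of_law hN h).const_mul 2)).mono'
    ((measurable_rx hp hx hN).norm.pow_const 2).aestronglyMeasurable (ae_of_all _ fun ω => by
      simpa using norm_rx_sq_le (r := r) (p := p ω) (n := N ω) (hpow ω))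

/-- A received signal of mean power of order `v` has conditional divergence at most of order
`log v` from the Gaussian law of variance `v`. -/
theorem condKL_rx_le {U : Ω → 𝒰} {N Y : Ω → ℂ} (hU : Measurable U) (hN : Measurable N)
    (h : P.map (fun ω => (U ω, N ω)) = (P.map U).prod stdComplexGaussian) {p x : 𝒰 → Vec}
    (hp : Measurable p) (hx : Measurable x) {r : ℝ} (hr : 1 ≤ r)
    (hY : ∀ ω, Y ω = rx r (p (U ω)) (x (U ω)) (N ω)) (hpow : ∀ u, ∑ i, ‖x u i‖ ^ 2 ≤ 1)
    (hip : Integrable (fun ω => ∑ i, ‖p (U ω) i‖ ^ 2) P) {H : ℝ}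
    (hH : ∫ ω, ∑ i, ‖p (U ω) i‖ ^ 2 ∂P ≤ H) :
    condKL P U Y (cgauss (r ^ 2)) ≤ ENNReal.ofReal (Real.log (r ^ 2) + (2 * H + 2 * noisePower)) := by
  have hlN : P.map N = stdComplexGaussian := by
    have := Measure.isProbabilityMeasure_map (μ := P) hU.aemeasurable
    have := congrArg Measure.snd h
    rwa [Measure.snd_map_prodMk hU, Measure.snd_prod] at this
  obtain rfl : Y = fun ω => rx r (p (U ω)) (x (U ω)) (N ω) := funext hY
  have hi := integrable_norm_rx_sq (P := P) r (hp.comp hU) (hx.comp hU) hN (fun ω => hpow (U ω)) hip hlN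
  refine condKL_shift_le hU hN h (m := fun u => (r : ℂ) * ∑ i, p u i * x u i) (by fun_prop)
    (fun ω => rfl) (by positivity) hi ?_
  have h1 : ∫ ω, ‖rx r (p (U ω)) (x (U ω)) (N ω)‖ ^ 2 ∂P ≤
      ∫ ω, (2 * r ^ 2 * ∑ i, ‖p (U ω) i‖ ^ 2 + 2 * ‖N ω‖ ^ 2) ∂P :=
    integral_mono hi ((hip.const_mul _).add ((integrable_norm_sq_of_law hN hlN).const_mul 2))
      fun ω => norm_rx_sq_le (hpow _)
  rw [integral_add (hip.const_mul _) ((integrable_norm_sq_of_law hN hlN).const_mul 2),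
    integral_const_mul, integral_const_mul, integral_norm_sq_of_law hN hlN] at h1
  -- A gain of at least 1 lets the noise power be absorbed into a multiple of `r ^ 2`, so the
  -- constant is independent of the power.
  have h2 : 1 ≤ r ^ 2 := by nlinarith
  refine h1.trans ?_
  nlinarith [noisePower_nonneg, mul_le_mul_of_nonneg_left hH (by positivity : 0 ≤ 2 * r ^ 2),
    mul_le_mul_of_nonneg_right h2 noisePower_nonneg]

end Received

/-! ### Independence expressed as product form of joint laws. -/

section ProductLaws

variable {Ω 𝒢 α β : Type*} [MeasurableSpace Ω] [MeasurableSpace 𝒢] [MeasurableSpace α]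
  [MeasurableSpace β] {P : Measure Ω} [IsProbabilityMeasure P] {μ : Measure α}
  [IsProbabilityMeasure μ] {ν : Measure β} [IsProbabilityMeasure ν]

theorem map_prod_fst_comp {g : Ω → 𝒢} (hg : Measurable g) :
    (P.prod μ).map (fun x => g x.1) = P.map g := by
  rw [show (fun x : Ω × α => g x.1) = g ∘ Prod.fst from rfl,
    ← Measure.map_map hg measurable_fst, measurePreserving_fst.map_eq]

theorem map_prod_indep {g : Ω → 𝒢} (hg : Measurable g) :
    (P.prod μ).map (fun x => (g x.1, x.2)) = (P.map g).prod μ := by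
  rw [show (fun x : Ω × α => (g x.1, x.2)) = Prod.map g id from rfl,
    ← Measure.map_prod_map _ _ hg measurable_id, Measure.map_id]

theorem map_prod_indep_snd {g : Ω → 𝒢} (hg : Measurable g) :
    (P.prod (μ.prod ν)).map (fun x => ((g x.1, x.2.1), x.2.2)) =
      ((P.prod (μ.prod ν)).map fun x => (g x.1, x.2.1)).prod ν := by
  have := Measure.isProbabilityMeasure_map (μ := P) hg.aemeasurable
  have h1 : (P.prod (μ.prod ν)).map (fun x => (g x.1, x.2)) = (P.map g).prod (μ.prod ν) :=
    map_prod_indep hg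
  have h2 : (P.prod (μ.prod ν)).map (fun x => (g x.1, x.2.1)) = (P.map g).prod μ := by
    rw [show (fun x : Ω × (α × β) => (g x.1, x.2.1)) = Prod.map id Prod.fst ∘
      fun x : Ω × (α × β) => (g x.1, x.2) from rfl, ← Measure.map_map (by fun_prop) (by fun_prop),
      h1, ← Measure.map_prod_map _ _ measurable_id measurable_fst, Measure.map_id,
      measurePreserving_fst.map_eq]
  rw [h2, ← (measurePreserving_prodAssoc (P.map g) μ ν).symm.map_eq, ← h1,
    Measure.map_map (MeasurableEquiv.measurable _) (by fun_prop)]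
  rfl

theorem measurePreserving_prod_right_comm {γ : Type*} [MeasurableSpace γ] (μ : Measure α)
    [IsProbabilityMeasure μ] (ν : Measure β) [IsProbabilityMeasure ν] (ξ : Measure γ)
    [IsProbabilityMeasure ξ] :
    MeasurePreserving (fun x : (α × β) × γ => ((x.1.1, x.2), x.1.2)) ((μ.prod ν).prod ξ)
      ((μ.prod ξ).prod ν) :=
  (measurePreserving_prodAssoc μ ξ ν).symm.comp
    (((MeasurePreserving.id μ).prod Measure.measurePreserving_swap).comp
      (measurePreserving_prodAssoc μ ν ξ))

/-- If `T` is independent of `U` with law `μ`, then so is any function of `T` of any function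
of `U`. -/
theorem map_indep_comp {𝒢' α' : Type*} [MeasurableSpace 𝒢'] [MeasurableSpace α'] {U : Ω → 𝒢}
    {T : Ω → α} (hU : Measurable U) (hT : Measurable T)
    (h : P.map (fun ω => (U ω, T ω)) = (P.map U).prod μ)
    {f : 𝒢 → 𝒢'} {g : α → α'} (hf : Measurable f) (hg : Measurable g) {μ' : Measure α'}
    (hμ' : μ.map g = μ') :
    P.map (fun ω => (f (U ω), g (T ω))) = (P.map fun ω => f (U ω)).prod μ' := by
  rw [show (fun ω => (f (U ω), g (T ω))) = Prod.map f g ∘ fun ω => (U ω, T ω) from rfl,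
    ← Measure.map_map (hf.prodMap hg) (hU.prodMk hT), h, ← Measure.map_prod_map _ _ hf hg, hμ',
    Measure.map_map hf hU]
  rfl

end ProductLaws

/-! ### Predicting one receiver's output from two looks at the other's. -/

section Prediction

/-- The determinant of the matrix with rows `u` and `v`. -/
def det₂ (u v : Vec) : ℂ := u 0 * v 1 - u 1 * v 0

theorem fullRank_iff (u v : Vec) : FullRank u v ↔ det₂ u v ≠ 0 := by
  simp [FullRank, det₂, Matrix.det_fin_two]

@[fun_prop]
theorem measurable_det₂ {α : Type*} [MeasurableSpace α] {u v : α → Vec} (hu : Measurable u)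
    (hv : Measurable v) : Measurable fun a => det₂ (u a) (v a) := by
  unfold det₂; fun_prop

/-- Cramer's rule for writing `q` in the basis `p`, `p'`. -/
theorem eq_comb {p p' q : Vec} (h : det₂ p p' ≠ 0) (i : Fin 2) :
    q i = det₂ q p' / det₂ p p' * p i + det₂ p q / det₂ p p' * p' i := by
  rw [div_mul_eq_mul_div, div_mul_eq_mul_div, ← add_div, eq_div_iff h]
  unfold det₂
  fin_cases i <;> simp <;> ring

/-- Pairs of states for which `q` of the first is a combination with bounded coefficients of the
vectors `p` of both. -/
def goodPairs (p q : State → Vec) (B : ℝ) : Set (State × State) :=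
  {x | det₂ (p x.1) (p x.2) ≠ 0 ∧
    ‖det₂ (q x.1) (p x.2) / det₂ (p x.1) (p x.2)‖ ^ 2 ≤ B ∧
    ‖det₂ (p x.1) (q x.1) / det₂ (p x.1) (p x.2)‖ ^ 2 ≤ B}

theorem measurableSet_goodPairs {p q : State → Vec} (hp : Measurable p) (hq : Measurable q)
    (B : ℝ) : MeasurableSet (goodPairs p q B) := by
  have h1 : Measurable fun x : State × State => det₂ (p x.1) (p x.2) := by fun_prop
  have h2 : Measurable fun x : State × State =>
    ‖det₂ (q x.1) (p x.2) / det₂ (p x.1) (p x.2)‖ ^ 2 := by fun_prop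
  have h3 : Measurable fun x : State × State =>
    ‖det₂ (p x.1) (q x.1) / det₂ (p x.1) (p x.2)‖ ^ 2 := by fun_prop
  exact (h1 (measurableSet_singleton 0)).compl.inter
    ((measurableSet_le h2 measurable_const).inter (measurableSet_le h3 measurable_const))

/-- The good sets increase with the bound and exhaust the event that the two vectors are linearly
independent, which has probability 1. Continuity from below does the rest; no quantitative
assumption on the fading is required. -/
theorem exists_goodPairs {p q : State → Vec} (hp : Measurable p) (hq : Measurable q)
    (ν : Measure State) [IsProbabilityMeasure ν]
    (hfull : ∀ᵐ x ∂(ν.prod ν), FullRank (p x.1) (p x.2)) {ε : ℝ} (hε : 0 < ε) :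
    ∃ B : ℝ, 0 ≤ B ∧ 1 - ε ≤ (ν.prod ν).real (goodPairs p q B) := by
  have hmono : Monotone fun n : ℕ => goodPairs p q n := fun m n hmn x hx =>
    ⟨hx.1, hx.2.1.trans (by exact_mod_cast hmn), hx.2.2.trans (by exact_mod_cast hmn)⟩
  have hun : (ν.prod ν) (⋃ n : ℕ, goodPairs p q n) = 1 := by
    rw [← prob_compl_eq_zero_iff (MeasurableSet.iUnion fun n : ℕ =>
      measurableSet_goodPairs hp hq (n : ℝ))]
    refine measure_mono_null ?_ (ae_iff.1 hfull)
    intro x hx hx'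
    rw [fullRank_iff] at hx'
    refine hx (Set.mem_iUnion.2 ?_)
    obtain ⟨n, hn⟩ := exists_nat_ge (max (‖det₂ (q x.1) (p x.2) / det₂ (p x.1) (p x.2)‖ ^ 2)
      (‖det₂ (p x.1) (q x.1) / det₂ (p x.1) (p x.2)‖ ^ 2))
    exact ⟨n, hx', (le_max_left _ _).trans hn, (le_max_right _ _).trans hn⟩
  have ht := tendsto_measure_iUnion_atTop (μ := ν.prod ν) hmono
  rw [hun] at ht
  have ht' := (ENNReal.tendsto_toReal ENNReal.one_ne_top).comp ht
  rw [ENNReal.toReal_one] at ht'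
  obtain ⟨n, hn⟩ := (ht'.eventually_const_le (show 1 - ε < 1 by linarith)).exists
  exact ⟨n, n.cast_nonneg, hn⟩

variable {Ω 𝒰 : Type*} [MeasurableSpace Ω] [MeasurableSpace 𝒰]
  {P : Measure Ω} [IsProbabilityMeasure P]

/-- A good prediction of `Z` from `U` on the event `G` bounds the conditional divergence of `Z` from
below. -/
theorem le_condKL_of_predict {U : Ω → 𝒰} {Z : Ω → ℂ} (hU : Measurable U) (hZ : Measurable Z)
    {G : Set 𝒰} (hG : MeasurableSet G) {pred : 𝒰 → ℂ} (hpred : Measurable pred) {τ w : ℝ}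
    (hτ : 0 < τ) (hw : 0 < w) {E : Ω → ℝ} (hE : Integrable E P) (hE0 : ∀ ω, 0 ≤ E ω)
    (hle : ∀ ω, U ω ∈ G → ‖Z ω - pred (U ω)‖ ^ 2 ≤ τ * E ω)
    (hZi : Integrable (fun ω => ‖Z ω‖ ^ 2) P) :
    ENNReal.ofReal (P.real (U ⁻¹' G) * (Real.log w - Real.log τ) - ∫ ω, E ω ∂P) ≤
      condKL P U Z (cgauss w) := by
  classical
  have := isProbabilityMeasure_cgauss hw
  have := Measure.isProbabilityMeasure_map (μ := P) hU.aemeasurable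
  have := Measure.isProbabilityMeasure_map (μ := P) (hU.prodMk hZ).aemeasurable
  have h1 := measurable_logGauss τ
  have h2 := measurable_logGauss w
  -- On `G` the test function is the log-likelihood ratio of the Gaussian centred at the prediction
  -- with variance `τ` against the reference; off `G` it is 0. For every fixed `u` its exponential
  -- integrates to 1.
  set f : 𝒰 × ℂ → ℝ := (Prod.fst ⁻¹' G).indicator
    fun x => logGauss τ (x.2 - pred x.1) - logGauss w x.2 with hf
  have hfm : Measurable f := Measurable.indicator (by fun_prop) (measurable_fst hG)
  have hval : ∀ ω, f (U ω, Z ω) = (U ⁻¹' G).indicator (fun ω =>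
      Real.log w - Real.log τ - ‖Z ω - pred (U ω)‖ ^ 2 / τ + ‖Z ω‖ ^ 2 / w) ω := by
    intro ω
    by_cases hω : U ω ∈ G
    · rw [hf, Set.indicator_of_mem (by exact hω), Set.indicator_of_mem (by exact hω), logGauss,
        logGauss, Real.log_mul Real.pi_pos.ne' hτ.ne', Real.log_mul Real.pi_pos.ne' hw.ne']
      ring
    · rw [hf, Set.indicator_of_notMem (by exact hω), Set.indicator_of_notMem (by exact hω)]
  have hfm' : Measurable fun ω => f (U ω, Z ω) := hfm.comp (hU.prodMk hZ)
  have hint : Integrable (fun ω => f (U ω, Z ω)) P := by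
    refine (((integrable_const |Real.log w - Real.log τ|).add hE).add (hZi.div_const w)).mono'
      hfm'.aestronglyMeasurable (ae_of_all _ fun ω => ?_)
    rw [hval]
    by_cases hω : U ω ∈ G
    · rw [Set.indicator_of_mem (by exact hω), Real.norm_eq_abs]
      have hd : ‖Z ω - pred (U ω)‖ ^ 2 / τ ≤ E ω := (div_le_iff₀' hτ).2 (hle ω hω)
      have hd0 : 0 ≤ ‖Z ω - pred (U ω)‖ ^ 2 / τ := by positivity
      have hz0 : 0 ≤ ‖Z ω‖ ^ 2 / w := by positivity
      simp only [Pi.add_apply]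
      rw [abs_le]
      constructor <;> cases abs_cases (Real.log w - Real.log τ) <;> linarith
    · rw [Set.indicator_of_notMem (by exact hω), norm_zero]
      have := hE0 ω
      simp only [Pi.add_apply]
      positivity
  have hfi : Integrable f (P.map fun ω => (U ω, Z ω)) :=
    (integrable_map_measure hfm.aestronglyMeasurable (hU.prodMk hZ).aemeasurable).2 hint
  refine le_trans (ENNReal.ofReal_le_ofReal ?_) (ofReal_integral_le_klDiv _ _ hfi hfm ?_)
  · rw [integral_map (hU.prodMk hZ).aemeasurable hfm.aestronglyMeasurable]
    have hc : Integrable ((U ⁻¹' G).indicator fun _ => Real.log w - Real.log τ) P :=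
      (integrable_const _).indicator (hU hG)
    have e : P.real (U ⁻¹' G) * (Real.log w - Real.log τ) - ∫ ω, E ω ∂P =
        ∫ ω, ((U ⁻¹' G).indicator (fun _ => Real.log w - Real.log τ) ω - E ω) ∂P := by
      rw [integral_sub hc hE, integral_indicator (hU hG)]
      simp
    rw [e]
    refine integral_mono (hc.sub hE) hint fun ω => ?_
    simp only
    rw [hval]
    by_cases hω : U ω ∈ G
    · rw [Set.indicator_of_mem (by exact hω), Set.indicator_of_mem (by exact hω)]
      have hd : ‖Z ω - pred (U ω)‖ ^ 2 / τ ≤ E ω := (div_le_iff₀' hτ).2 (hle ω hω)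
      have hz0 : 0 ≤ ‖Z ω‖ ^ 2 / w := by positivity
      linarith
    · rw [Set.indicator_of_notMem (by exact hω), Set.indicator_of_notMem (by exact hω)]
      linarith [hE0 ω]
  · rw [lintegral_prod _ (by fun_prop)]
    have : ∀ u, ∫⁻ z, ENNReal.ofReal (Real.exp (f (u, z))) ∂cgauss w = 1 := by
      intro u
      by_cases hu : u ∈ G
      · rw [← lintegral_exp_logGauss_sub (v := w) hτ (pred u)]
        refine lintegral_congr fun z => ?_
        rw [hf, Set.indicator_of_mem (by exact hu)]
      · have : ∀ z, f (u, z) = 0 := fun z => by rw [hf, Set.indicator_of_notMem (by exact hu)]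
        simp [this]
    simp [this]

theorem norm_add_sq_le_three (a b c : ℂ) :
    ‖a + b + c‖ ^ 2 ≤ 3 * (‖a‖ ^ 2 + ‖b‖ ^ 2 + ‖c‖ ^ 2) := by
  have h := norm_add₃_le (a := a) (b := b) (c := c)
  nlinarith [norm_nonneg a, norm_nonneg b, norm_nonneg c, norm_nonneg (a + b + c),
    sq_nonneg (‖a‖ - ‖b‖), sq_nonneg (‖a‖ - ‖c‖), sq_nonneg (‖b‖ - ‖c‖)]

/-- Two observations of the input through the vectors `p, p'` predict the observation through
`q`. -/
theorem norm_rx_sub_pred_sq_le {p p' q x : Vec} {n n' m : ℂ} {r r' B : ℝ} (hr : 1 ≤ r)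
    (hB : 0 ≤ B) (hdet : det₂ p p' ≠ 0) (h1 : ‖det₂ q p' / det₂ p p'‖ ^ 2 ≤ B)
    (h2 : ‖det₂ p q / det₂ p p'‖ ^ 2 ≤ B) :
    ‖rx r' q x m - (r' / r : ℝ) * (det₂ q p' / det₂ p p' * rx r p x n +
      det₂ p q / det₂ p p' * rx r p' x n')‖ ^ 2 ≤
      (1 + r' ^ 2 / r ^ 2 * B) * (3 * (‖m‖ ^ 2 + ‖n‖ ^ 2 + ‖n'‖ ^ 2)) := by
  set c := det₂ q p' / det₂ p p' with hc
  set c' := det₂ p q / det₂ p p' with hc'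
  have hq : ∀ i, q i = c * p i + c' * p' i := eq_comb hdet
  have hr0 : (r : ℂ) ≠ 0 := by
    have : r ≠ 0 := by linarith
    exact_mod_cast this
  -- Since q = c p + c' p', rescaling by r'/r cancels the signal exactly. Only the three noises
  -- remain, two of them amplified by the coefficients.
  have e : rx r' q x m - (r' / r : ℝ) * (c * rx r p x n + c' * rx r p' x n') =
      m + (-((r' / r : ℝ) * c) * n) + (-((r' / r : ℝ) * c') * n') := by
    simp only [rx, Fin.sum_univ_two, hq]
    push_cast
    field_simp
    ring
  rw [e]
  refine (norm_add_sq_le_three _ _ _).trans ?_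
  simp only [norm_mul, norm_neg, Complex.norm_real, mul_pow, Real.norm_eq_abs, sq_abs, div_pow]
  have hk : 0 ≤ r' ^ 2 / r ^ 2 := by positivity
  have i1 : r' ^ 2 / r ^ 2 * ‖c‖ ^ 2 ≤ 1 + r' ^ 2 / r ^ 2 * B := by
    linarith [mul_le_mul_of_nonneg_left h1 hk]
  have i2 : r' ^ 2 / r ^ 2 * ‖c'‖ ^ 2 ≤ 1 + r' ^ 2 / r ^ 2 * B := by
    linarith [mul_le_mul_of_nonneg_left h2 hk]
  have i0 : 1 ≤ 1 + r' ^ 2 / r ^ 2 * B := by linarith [mul_nonneg hk hB]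
  linarith [mul_le_mul_of_nonneg_right i1 (sq_nonneg ‖n‖),
    mul_le_mul_of_nonneg_right i2 (sq_nonneg ‖n'‖), mul_le_mul_of_nonneg_right i0 (sq_nonneg ‖m‖)]

/-- With v and w the power gains of the predicting and the predicted link, noise is amplified by
about w/v. If w ≤ v the prediction gains log w, otherwise only log v. -/
theorem min_log_sub_le {v w B : ℝ} (hv : 1 ≤ v) (hw : 1 ≤ w) (hB : 0 ≤ B) :
    min (Real.log v) (Real.log w) - Real.log (1 + B) ≤
      Real.log w - Real.log (1 + w / v * B) := by
  have hv0 : 0 < v := by linarith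
  have hw0 : 0 < w := by linarith
  have hB1 : 0 < 1 + B := by linarith
  have hk : 0 < w / v := by positivity
  rcases le_total v w with h | h
  · rw [min_eq_left (Real.log_le_log hv0 h)]
    have hk1 : 1 ≤ w / v := (one_le_div hv0).2 h
    have : Real.log (1 + w / v * B) ≤ Real.log (w / v * (1 + B)) :=
      Real.log_le_log (by positivity) (by linarith)
    rw [Real.log_mul hk.ne' hB1.ne', Real.log_div hw0.ne' hv0.ne'] at this
    linarith
  · rw [min_eq_right (Real.log_le_log hw0 h)]
    have hk1 : w / v ≤ 1 := (div_le_one hv0).2 h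
    have : Real.log (1 + w / v * B) ≤ Real.log (1 + B) :=
      Real.log_le_log (by positivity) (by nlinarith)
    linarith

end Prediction

/-! ### The single-letter inequality from a statistically equivalent output. -/

section SingleLetter

variable {Ω 𝒱 : Type*} [MeasurableSpace Ω] [MeasurableSpace 𝒱]
  {P : Measure Ω} [IsProbabilityMeasure P]

set_option maxHeartbeats 1000000 in
/-- Under delayed channel knowledge, an observation is at least half as informative about the past
as the pair of observations, up to the difference of the link strengths. -/
theorem two_mul_condKL_le (ν : Measure State) [IsProbabilityMeasure ν] {p q : State → Vec}
    (hp : Measurable p) (hq : Measurable q) (hip : Integrable (fun s => ∑ i, ‖p s i‖ ^ 2) ν)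
    (hiq : Integrable (fun s => ∑ i, ‖q s i‖ ^ 2) ν) {H : ℝ}
    (hH : ∫ s, ∑ i, ‖p s i‖ ^ 2 ∂ν ≤ H) {V : Ω → 𝒱} {X : Ω → Vec} {S : Ω → State} {N N' : Ω → ℂ}
    (hV : Measurable V) (hX : Measurable X) (hS : Measurable S) (hN : Measurable N)
    (hN' : Measurable N') (hpow : ∀ ω, ∑ i, ‖X ω i‖ ^ 2 ≤ 1)
    (hlaw : P.map (fun ω => ((V ω, X ω), (S ω, N ω, N' ω))) =
      (P.map fun ω => (V ω, X ω)).prod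
        (ν.prod (stdComplexGaussian.prod stdComplexGaussian)))
    {r r' : ℝ} (hr : 1 ≤ r) (hr' : 1 ≤ r') {ε B : ℝ} (hB : 0 ≤ B)
    (hgood : 1 - ε ≤ (ν.prod ν).real (goodPairs p q B)) :
    2 * condKL P V (fun ω => (S ω, rx r (p (S ω)) (X ω) (N ω))) (ν.prod (cgauss (r ^ 2))) +
        ENNReal.ofReal ((1 - ε) * min (Real.log (r ^ 2)) (Real.log (r' ^ 2)) - Real.log (1 + B) -
          9 * noisePower) ≤
      condKL P V (fun ω => ((S ω, rx r (p (S ω)) (X ω) (N ω)), rx r' (q (S ω)) (X ω) (N' ω)))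
          ((ν.prod (cgauss (r ^ 2))).prod (cgauss (r' ^ 2))) +
        ENNReal.ofReal (Real.log (r ^ 2) + (2 * H + 2 * noisePower)) := by
  have hg1 : IsProbabilityMeasure (cgauss (r ^ 2)) := isProbabilityMeasure_cgauss (by positivity)
  have hg2 : IsProbabilityMeasure (cgauss (r' ^ 2)) := isProbabilityMeasure_cgauss (by positivity)
  -- The sample space is enlarged by a fresh state and noise, from which `Y'` is formed with the
  -- same input. The input is independent of both states, so the copy has the same joint law with
  -- `V`.
  set μ := P.prod (ν.prod stdComplexGaussian) with hμ
  set Y : Ω → ℂ := fun ω => rx r (p (S ω)) (X ω) (N ω) with hYdef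
  set Z : Ω → ℂ := fun ω => rx r' (q (S ω)) (X ω) (N' ω) with hZdef
  have hY : Measurable Y := by fun_prop
  have hZ : Measurable Z := by fun_prop
  set Y' : Ω × (State × ℂ) → ℂ := fun x => rx r (p x.2.1) (X x.1) x.2.2 with hY'def
  have hY' : Measurable Y' := by fun_prop
  have hVX : Measurable fun ω => (V ω, X ω) := hV.prodMk hX
  have hT : Measurable fun ω => (S ω, N ω, N' ω) := by fun_prop
  -- marginal laws
  have hlT : P.map (fun ω => (S ω, N ω, N' ω)) =
      ν.prod (stdComplexGaussian.prod stdComplexGaussian) := by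
    have := Measure.isProbabilityMeasure_map (μ := P) hVX.aemeasurable
    have := congrArg Measure.snd hlaw
    rwa [Measure.snd_map_prodMk hVX, Measure.snd_prod] at this
  have hlS : P.map S = ν := by
    rw [show S = Prod.fst ∘ fun ω => (S ω, N ω, N' ω) from rfl,
      ← Measure.map_map measurable_fst hT, hlT, measurePreserving_fst.map_eq]
  have hlN : P.map N = stdComplexGaussian := by
    rw [show N = (Prod.fst ∘ Prod.snd) ∘ fun ω => (S ω, N ω, N' ω) from rfl,
      ← Measure.map_map (by fun_prop) hT, hlT,
      (measurePreserving_fst.comp measurePreserving_snd).map_eq]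
  have hlN' : P.map N' = stdComplexGaussian := by
    rw [show N' = (Prod.snd ∘ Prod.snd) ∘ fun ω => (S ω, N ω, N' ω) from rfl,
      ← Measure.map_map (by fun_prop) hT, hlT,
      (measurePreserving_snd.comp measurePreserving_snd).map_eq]
  have hpf : μ.map Prod.fst = P := measurePreserving_fst.map_eq
  -- the observation with the independent copy has the same divergence
  have e0 : condKL μ (fun x => V x.1) (fun x => (S x.1, Y x.1)) (ν.prod (cgauss (r ^ 2))) =
      condKL P V (fun ω => (S ω, Y ω)) (ν.prod (cgauss (r ^ 2))) := by
    refine condKL_congr (by fun_prop) (by fun_prop) ?_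
    exact map_prod_fst_comp (g := fun ω => (V ω, S ω, Y ω)) (by fun_prop)
  have e1 : condKL μ (fun x => V x.1) (fun x => (x.2.1, Y' x)) (ν.prod (cgauss (r ^ 2))) =
      condKL P V (fun ω => (S ω, Y ω)) (ν.prod (cgauss (r ^ 2))) := by
    refine condKL_congr (by fun_prop) (by fun_prop) ?_
    have hφ : Measurable fun x : (𝒱 × Vec) × (State × ℂ) =>
      (x.1.1, (x.2.1, rx r (p x.2.1) x.1.2 x.2.2)) := by fun_prop
    have a1 : μ.map (fun x => ((V x.1, X x.1), x.2)) =
        (P.map fun ω => (V ω, X ω)).prod (ν.prod stdComplexGaussian) :=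
      map_prod_indep hVX
    have a2 : P.map (fun ω => ((V ω, X ω), (S ω, N ω))) =
        (P.map fun ω => (V ω, X ω)).prod (ν.prod stdComplexGaussian) := by
      exact map_indep_comp hVX hT hlaw (f := id) (g := fun t => (t.1, t.2.1)) measurable_id
        (by fun_prop) ((MeasurePreserving.id ν).prod measurePreserving_fst).map_eq
    calc μ.map (fun x => (V x.1, (x.2.1, Y' x)))
        = (μ.map fun x => ((V x.1, X x.1), x.2)).map
          (fun x => (x.1.1, (x.2.1, rx r (p x.2.1) x.1.2 x.2.2))) := by
            rw [Measure.map_map hφ (by fun_prop)]; rfl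
      _ = (P.map fun ω => ((V ω, X ω), (S ω, N ω))).map
          (fun x => (x.1.1, (x.2.1, rx r (p x.2.1) x.1.2 x.2.2))) := by rw [a1, a2]
      _ = _ := by rw [Measure.map_map hφ (by fun_prop)]; rfl
  -- both copies together
  have e2 : 2 * condKL P V (fun ω => (S ω, Y ω)) (ν.prod (cgauss (r ^ 2))) ≤
      condKL μ (fun x => V x.1) (fun x => ((S x.1, Y x.1), (x.2.1, Y' x)))
        ((ν.prod (cgauss (r ^ 2))).prod (ν.prod (cgauss (r ^ 2)))) := by
    rw [condKL_chain (P := μ) (V := fun x => (S x.1, Y x.1)) (W := fun x => (x.2.1, Y' x))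
      (by fun_prop) (by fun_prop) (by fun_prop), e0, two_mul]
    gcongr
    rw [← e1]
    exact condKL_comp_left_le (f := Prod.fst) (U := fun x : Ω × (State × ℂ) =>
      (V x.1, (S x.1, Y x.1))) (by fun_prop) (by fun_prop) measurable_fst
  -- prediction of the other observation from both copies
  have e3 : ENNReal.ofReal ((1 - ε) * min (Real.log (r ^ 2)) (Real.log (r' ^ 2)) -
        Real.log (1 + B) - 9 * noisePower) ≤
      condKL μ (fun x => (V x.1, ((S x.1, Y x.1), (x.2.1, Y' x)))) (fun x => Z x.1)
        (cgauss (r' ^ 2)) := by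
    have hN1 : μ.map (fun x => N x.1) = stdComplexGaussian := by
      rw [map_prod_fst_comp hN, hlN]
    have hN2 : μ.map (fun x => N' x.1) = stdComplexGaussian := by
      rw [map_prod_fst_comp hN', hlN']
    have hN3 : μ.map (fun x => x.2.2) = stdComplexGaussian :=
      (measurePreserving_snd.comp measurePreserving_snd).map_eq
    have hS2 : μ.map (fun x => (S x.1, x.2.1)) = ν.prod ν := by
      have := (MeasurePreserving.prod (⟨hS, hlS⟩ : MeasurePreserving S P ν)
        (measurePreserving_fst (μ := ν) (ν := stdComplexGaussian))).map_eq
      exact this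
    have i1 := integrable_norm_sq_of_law (P := μ) (by fun_prop) hN1
    have i2 := integrable_norm_sq_of_law (P := μ) (by fun_prop) hN2
    have i3 := integrable_norm_sq_of_law (P := μ) (by fun_prop) hN3
    have hEi : Integrable (fun x : Ω × (State × ℂ) =>
        3 * (‖N' x.1‖ ^ 2 + ‖N x.1‖ ^ 2 + ‖x.2.2‖ ^ 2)) μ := ((i2.add i1).add i3).const_mul 3
    have hgm := measurableSet_goodPairs hp hq B
    have hGm : Measurable fun u : 𝒱 × ((State × ℂ) × (State × ℂ)) => (u.2.1.1, u.2.2.1) := by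
      fun_prop
    have hpredm : Measurable fun u : 𝒱 × ((State × ℂ) × (State × ℂ)) =>
        ((r' / r : ℝ) : ℂ) * (det₂ (q u.2.1.1) (p u.2.2.1) / det₂ (p u.2.1.1) (p u.2.2.1) * u.2.1.2 +
          det₂ (p u.2.1.1) (q u.2.1.1) / det₂ (p u.2.1.1) (p u.2.2.1) * u.2.2.2) := by
      fun_prop
    have hτ : 0 < 1 + r' ^ 2 / r ^ 2 * B := by positivity
    have hZi : Integrable (fun x : Ω × (State × ℂ) => ‖Z x.1‖ ^ 2) μ := by
      have := integrable_norm_rx_sq (P := P) r' (hq.comp hS) hX hN' hpow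
        (by
          have h' := hiq
          rw [← hlS] at h'
          exact h'.comp_measurable hS) hlN'
      exact this.comp_fst _
    refine le_trans (ENNReal.ofReal_le_ofReal ?_) (le_condKL_of_predict
      (U := fun x : Ω × (State × ℂ) => (V x.1, ((S x.1, Y x.1), (x.2.1, Y' x)))) (by fun_prop)
      (hZ.comp measurable_fst) (hGm hgm) hpredm hτ (w := r' ^ 2) (by positivity)
      hEi (fun x => by positivity)
      (fun x hx => norm_rx_sub_pred_sq_le hr hB hx.1 hx.2.1 hx.2.2) hZi)
    -- A factor 3 from the square of a sum of three terms, times three noises.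
    have hE : ∫ x, 3 * (‖N' x.1‖ ^ 2 + ‖N x.1‖ ^ 2 + ‖x.2.2‖ ^ 2) ∂μ = 9 * noisePower := by
      rw [integral_const_mul, integral_add (f := fun x : Ω × (State × ℂ) =>
        ‖N' x.1‖ ^ 2 + ‖N x.1‖ ^ 2) (i2.add i1) i3, integral_add i2 i1,
        integral_norm_sq_of_law (by fun_prop) hN1, integral_norm_sq_of_law (by fun_prop) hN2,
        integral_norm_sq_of_law (by fun_prop) hN3]
      ring
    have hprob : μ.real ((fun x : Ω × (State × ℂ) => (V x.1, ((S x.1, Y x.1), (x.2.1, Y' x)))) ⁻¹'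
        ((fun u : 𝒱 × ((State × ℂ) × (State × ℂ)) => (u.2.1.1, u.2.2.1)) ⁻¹' goodPairs p q B)) =
        (ν.prod ν).real (goodPairs p q B) := by
      rw [← hS2, Measure.real, Measure.real, Measure.map_apply (by fun_prop) hgm]
      rfl
    rw [hE, hprob]
    have hr2 : 1 ≤ r ^ 2 := by nlinarith
    have hr2' : 1 ≤ r' ^ 2 := by nlinarith
    -- The probability of a good pair multiplies min - log(1+B). Being at least 1-ε it keeps (1-ε)
    -- min, and being at most 1 it costs no more than log(1+B).
    have hm := min_log_sub_le hr2 hr2' hB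
    have hmin : 0 ≤ min (Real.log (r ^ 2)) (Real.log (r' ^ 2)) :=
      le_min (Real.log_nonneg hr2) (Real.log_nonneg hr2')
    have hL : 0 ≤ Real.log (1 + B) := Real.log_nonneg (by linarith)
    have hp0 : 0 ≤ (ν.prod ν).real (goodPairs p q B) := measureReal_nonneg
    have hp1 : (ν.prod ν).real (goodPairs p q B) ≤ 1 := measureReal_le_one
    nlinarith [mul_le_mul_of_nonneg_left hm hp0, mul_le_mul_of_nonneg_right hgood hmin,
      mul_le_mul_of_nonneg_right hp1 hL]
  -- exchanging the roles of the second copy and the other observation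
  have e4 : condKL μ (fun x => V x.1) (fun x => (((S x.1, Y x.1), (x.2.1, Y' x)), Z x.1))
        (((ν.prod (cgauss (r ^ 2))).prod (ν.prod (cgauss (r ^ 2)))).prod (cgauss (r' ^ 2))) ≤
      condKL μ (fun x => V x.1) (fun x => (((S x.1, Y x.1), Z x.1), (x.2.1, Y' x)))
        (((ν.prod (cgauss (r ^ 2))).prod (cgauss (r' ^ 2))).prod (ν.prod (cgauss (r ^ 2)))) := by
    have hmp := measurePreserving_prod_right_comm (ν.prod (cgauss (r ^ 2))) (cgauss (r' ^ 2))
      (ν.prod (cgauss (r ^ 2)))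
    exact condKL_comp_right_le (U := fun x : Ω × (State × ℂ) => V x.1)
      (V := fun x => (((S x.1, Y x.1), Z x.1), (x.2.1, Y' x))) (by fun_prop) (by fun_prop)
      hmp.measurable hmp.map_eq
  rw [condKL_chain (P := μ) (V := fun x => ((S x.1, Y x.1), (x.2.1, Y' x))) (W := fun x => Z x.1)
      (by fun_prop) (by fun_prop) (by fun_prop),
    condKL_chain (P := μ) (V := fun x => ((S x.1, Y x.1), Z x.1)) (W := fun x => (x.2.1, Y' x))
      (by fun_prop) (by fun_prop) (by fun_prop),
    condKL_chain (P := μ) (V := fun x => x.2.1) (W := Y') (by fun_prop) (by fun_prop)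
      (by fun_prop)] at e4
  have e5 : condKL μ (fun x => V x.1) (fun x => ((S x.1, Y x.1), Z x.1))
        ((ν.prod (cgauss (r ^ 2))).prod (cgauss (r' ^ 2))) =
      condKL P V (fun ω => ((S ω, Y ω), Z ω)) ((ν.prod (cgauss (r ^ 2))).prod (cgauss (r' ^ 2))) := by
    refine condKL_congr (by fun_prop) (by fun_prop) ?_
    exact map_prod_fst_comp (g := fun ω => (V ω, (S ω, Y ω), Z ω)) (by fun_prop)
  have e6 : condKL μ (fun x => (V x.1, (S x.1, Y x.1), Z x.1)) (fun x => x.2.1) ν = 0 := by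
    refine condKL_eq_zero ?_
    have hm : Measurable fun ω => (V ω, (S ω, Y ω), Z ω) := by fun_prop
    have := map_indep_comp (P := μ) (U := fun x => (V x.1, (S x.1, Y x.1), Z x.1))
      (T := fun x => x.2) (μ := ν.prod stdComplexGaussian) (by fun_prop) measurable_snd
      (by rw [map_prod_fst_comp hm]; exact map_prod_indep hm) measurable_id measurable_fst
      measurePreserving_fst.map_eq
    exact this
  have e7 : condKL μ (fun x => ((V x.1, (S x.1, Y x.1), Z x.1), x.2.1)) Y' (cgauss (r ^ 2)) ≤
      ENNReal.ofReal (Real.log (r ^ 2) + (2 * H + 2 * noisePower)) := by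
    -- `condKL_rx_le` wants the power bound at every value of the conditioning variable, so the
    -- input is adjoined as an element of the unit ball. Enlarging the conditioning only increases
    -- the divergence.
    have hm : Measurable fun ω => ((V ω, (S ω, Y ω), Z ω), (⟨X ω, hpow ω⟩ :
      {x : Vec // ∑ i, ‖x i‖ ^ 2 ≤ 1})) := by fun_prop
    set U : Ω × (State × ℂ) → ((𝒱 × (State × ℂ) × ℂ) × {x : Vec // ∑ i, ‖x i‖ ^ 2 ≤ 1}) × State :=
      fun x => (((V x.1, (S x.1, Y x.1), Z x.1), ⟨X x.1, hpow x.1⟩), x.2.1) with hU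
    have hUm : Measurable U := (hm.comp measurable_fst).prodMk (by fun_prop)
    refine (condKL_comp_left_le (U := U) (f := fun u => (u.1.1, u.2)) hUm hY'
      (by fun_prop)).trans ?_
    have hpS : μ.map (fun x => x.2.1) = ν :=
      (measurePreserving_fst.comp measurePreserving_snd).map_eq
    have hmS : Measurable fun x : Ω × (State × ℂ) => x.2.1 := by fun_prop
    have hind : μ.map (fun x => (U x, x.2.2)) = (μ.map U).prod stdComplexGaussian :=
      map_prod_indep_snd hm
    have hpm : Measurable fun u : ((𝒱 × (State × ℂ) × ℂ) × {x : Vec // ∑ i, ‖x i‖ ^ 2 ≤ 1}) ×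
      State => p u.2 := hp.comp measurable_snd
    have hxm : Measurable fun u : ((𝒱 × (State × ℂ) × ℂ) × {x : Vec // ∑ i, ‖x i‖ ^ 2 ≤ 1}) ×
      State => (u.1.2 : Vec) := measurable_subtype_coe.comp (measurable_snd.comp measurable_fst)
    refine condKL_rx_le hUm (by fun_prop) hind hpm hxm hr
      (fun x => rfl) (fun u => u.1.2.2) ?_ ?_
    · have h' := hip
      rw [← hpS] at h'
      exact h'.comp_measurable hmS
    · have : ∫ s, ∑ i, ‖p s i‖ ^ 2 ∂(μ.map fun x => x.2.1) ≤ H := by rw [hpS]; exact hH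
      rwa [integral_map hmS.aemeasurable (by fun_prop)] at this
  rw [e5, e6, zero_add] at e4
  exact (add_le_add e2 e3).trans (e4.trans (add_le_add le_rfl e7))

end SingleLetter

/-! ### Block transmission with delayed channel knowledge, symmetric in the receivers. -/

theorem map_indep_assoc {Ω 𝒢 α β : Type*} [MeasurableSpace Ω] [MeasurableSpace 𝒢]
    [MeasurableSpace α] [MeasurableSpace β] {P : Measure Ω} [IsProbabilityMeasure P]
    {μ : Measure α} [IsProbabilityMeasure μ] {ν : Measure β} [IsProbabilityMeasure ν] {U : Ω → 𝒢}
    {A : Ω → α} {B : Ω → β} (hU : Measurable U) (hA : Measurable A) (hB : Measurable B)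
    (h : P.map (fun ω => (U ω, (A ω, B ω))) = (P.map U).prod (μ.prod ν)) :
    P.map (fun ω => ((U ω, A ω), B ω)) = (P.map fun ω => (U ω, A ω)).prod ν := by
  have := Measure.isProbabilityMeasure_map (μ := P) hU.aemeasurable
  have h2 : P.map (fun ω => (U ω, A ω)) = (P.map U).prod μ := by
    have := map_indep_comp hU (hA.prodMk hB) h measurable_id measurable_fst
      measurePreserving_fst.map_eq
    exact this
  rw [h2, ← (measurePreserving_prodAssoc (P.map U) μ ν).symm.map_eq, ← h,
    Measure.map_map (MeasurableEquiv.measurable _) (by fun_prop)]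
  rfl

/-- `n` uses of a two-user channel with delayed channel knowledge at the transmitter. The channel
vectors of the two receivers are `p s` and `q s` when the state is `s`. -/
structure Transmission {Ω β : Type*} [MeasurableSpace Ω] [MeasurableSpace β] (P : Measure Ω)
    (ν : Measure State) (p q : State → Vec) (n : ℕ) where
  base : Ω → β
  S : Ω → Fin n → State
  N : Ω → Fin n → ℂ
  N' : Ω → Fin n → ℂ
  enc : (t : Fin n) → β → (Fin (t : ℕ) → State) → Vec
  r : Fin n → ℝ
  r' : Fin n → ℝ
  measurable_base : Measurable base
  measurable_S : Measurable S
  measurable_N : Measurable N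
  measurable_N' : Measurable N'
  measurable_enc : ∀ t : Fin n, Measurable fun x : β × (Fin (t : ℕ) → State) => enc t x.1 x.2
  power : ∀ t b s, ∑ i, ‖enc t b s i‖ ^ 2 ≤ 1
  one_le_r : ∀ t, 1 ≤ r t
  one_le_r' : ∀ t, 1 ≤ r' t
  law : P.map (fun ω => (base ω, (S ω, (N ω, N' ω)))) =
    (P.map base).prod ((Measure.pi fun _ => ν).prod ((Measure.pi fun _ => stdComplexGaussian).prod
      (Measure.pi fun _ => stdComplexGaussian)))
  measurable_p : Measurable p
  measurable_q : Measurable q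
  integrable_p : Integrable (fun s => ∑ i, ‖p s i‖ ^ 2) ν
  integrable_q : Integrable (fun s => ∑ i, ‖q s i‖ ^ 2) ν
  -- The two channel vectors must determine the state, since a receiver learns the state only
  -- through them. Abstract `p`, `q` and `join` make the structure closed under `swap`.
  join : Vec → Vec → State
  measurable_join : Measurable fun x : Vec × Vec => join x.1 x.2
  join_eq : ∀ s, join (p s) (q s) = s

namespace Transmission

variable {Ω β 𝒰 : Type*} [MeasurableSpace Ω] [MeasurableSpace β] [MeasurableSpace 𝒰]
  {P : Measure Ω} [IsProbabilityMeasure P]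
  {ν : Measure State} [IsProbabilityMeasure ν] {p q : State → Vec} {n : ℕ}

/-- Exchange of the two receivers. -/
def swap (m : Transmission (β := β) P ν p q n) : Transmission (β := β) P ν q p n where
  base := m.base
  S := m.S
  N := m.N'
  N' := m.N
  enc := m.enc
  r := m.r'
  r' := m.r
  measurable_base := m.measurable_base
  measurable_S := m.measurable_S
  measurable_N := m.measurable_N'
  measurable_N' := m.measurable_N
  measurable_enc := m.measurable_enc
  power := m.power
  one_le_r := m.one_le_r'
  one_le_r' := m.one_le_r
  law := map_indep_comp m.measurable_base
    (m.measurable_S.prodMk (m.measurable_N.prodMk m.measurable_N')) m.law (f := id)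
    (g := Prod.map id Prod.swap) measurable_id (measurable_id.prodMap measurable_swap)
    ((MeasurePreserving.id _).prod Measure.measurePreserving_swap).map_eq
  measurable_p := m.measurable_q
  measurable_q := m.measurable_p
  integrable_p := m.integrable_q
  integrable_q := m.integrable_p
  join := fun u v => m.join v u
  measurable_join := m.measurable_join.comp measurable_swap
  join_eq := m.join_eq

variable (m : Transmission (β := β) P ν p q n)

/-- States and noises at each time. -/
def T (ω : Ω) (t : Fin n) : State × ℂ × ℂ := (m.S ω t, m.N ω t, m.N' ω t)

/-- Channel input. -/
def X (ω : Ω) (t : Fin n) : Vec := m.enc t (m.base ω) (pre t (m.S ω))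

/-- Output at the first receiver. -/
noncomputable def Y (ω : Ω) (t : Fin n) : ℂ := rx (m.r t) (p (m.S ω t)) (m.X ω t) (m.N ω t)

/-- Output at the second receiver. -/
noncomputable def Z (ω : Ω) (t : Fin n) : ℂ := rx (m.r' t) (q (m.S ω t)) (m.X ω t) (m.N' ω t)

/-- States and outputs at the first receiver. -/
noncomputable def SY (ω : Ω) (t : Fin n) : State × ℂ := (m.S ω t, m.Y ω t)

/-- States and outputs at the second receiver. -/
noncomputable def SZ (ω : Ω) (t : Fin n) : State × ℂ := (m.S ω t, m.Z ω t)

/-- States and outputs at both receivers. -/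
noncomputable def SYZ (ω : Ω) (t : Fin n) : (State × ℂ) × ℂ := ((m.S ω t, m.Y ω t), m.Z ω t)

/-- Reference law for the outputs at the first receiver. -/
noncomputable def γ (t : Fin n) : Measure ℂ := cgauss (m.r t ^ 2)

/-- Reference law for the outputs at the second receiver. -/
noncomputable def γ' (t : Fin n) : Measure ℂ := cgauss (m.r' t ^ 2)

/-- The observation at the first receiver. -/
noncomputable def view (ω : Ω) : View n :=
  (m.Y ω, fun t => p (m.S ω t), fun t => q (m.S ω (Fin.castLE (Nat.sub_le n 1) t)))

instance (t : Fin n) : IsProbabilityMeasure (m.γ t) :=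
  isProbabilityMeasure_cgauss (by have := m.one_le_r t; positivity)

instance (t : Fin n) : IsProbabilityMeasure (m.γ' t) :=
  isProbabilityMeasure_cgauss (by have := m.one_le_r' t; positivity)

@[fun_prop]
theorem measurable_S_apply (t : Fin n) : Measurable fun ω => m.S ω t :=
  (measurable_pi_apply t).comp m.measurable_S

@[fun_prop]
theorem measurable_N_apply (t : Fin n) : Measurable fun ω => m.N ω t :=
  (measurable_pi_apply t).comp m.measurable_N

@[fun_prop]
theorem measurable_N'_apply (t : Fin n) : Measurable fun ω => m.N' ω t :=
  (measurable_pi_apply t).comp m.measurable_N'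

@[fun_prop]
theorem measurable_X_apply (t : Fin n) : Measurable fun ω => m.X ω t :=
  (m.measurable_enc t).comp (m.measurable_base.prodMk ((measurable_pre t).comp m.measurable_S))

@[fun_prop]
theorem measurable_Y_apply (t : Fin n) : Measurable fun ω => m.Y ω t :=
  measurable_rx (m.measurable_p.comp (m.measurable_S_apply t)) (m.measurable_X_apply t)
    (m.measurable_N_apply t)

@[fun_prop]
theorem measurable_Z_apply (t : Fin n) : Measurable fun ω => m.Z ω t :=
  m.swap.measurable_Y_apply t

theorem measurable_T : Measurable m.T := measurable_pi_lambda _ fun t => by unfold T; fun_prop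

theorem measurable_Y : Measurable m.Y := measurable_pi_lambda _ fun t => m.measurable_Y_apply t

theorem measurable_SY : Measurable m.SY := measurable_pi_lambda _ fun t => by unfold SY; fun_prop

theorem measurable_SZ : Measurable m.SZ := measurable_pi_lambda _ fun t => by unfold SZ; fun_prop

theorem measurable_SYZ : Measurable m.SYZ :=
  measurable_pi_lambda _ fun t => by unfold SYZ; fun_prop

theorem measurable_view : Measurable m.view := by
  have h1 := m.measurable_p
  have h2 := m.measurable_q
  exact m.measurable_Y.prodMk ((measurable_pi_lambda _ fun t => by fun_prop).prodMk
    (measurable_pi_lambda _ fun t => by fun_prop))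

theorem power_X (ω : Ω) (t : Fin n) : ∑ i, ‖m.X ω t i‖ ^ 2 ≤ 1 := m.power _ _ _

/-- Per-letter upper bound for the first receiver. -/
noncomputable def up (t : Fin n) : ℝ :=
  Real.log (m.r t ^ 2) + (2 * ∫ s, ∑ i, ‖p s i‖ ^ 2 ∂ν + 2 * noisePower)

theorem up_nonneg (t : Fin n) : 0 ≤ m.up t := by
  have h1 : 0 ≤ Real.log (m.r t ^ 2) := Real.log_nonneg (by nlinarith [m.one_le_r t])
  have h2 : 0 ≤ ∫ s, ∑ i, ‖p s i‖ ^ 2 ∂ν := integral_nonneg fun _ => by positivity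
  have := noisePower_nonneg
  unfold up
  positivity

/-- The triples of state and noises are independent of the base, and of each other. -/
theorem law_T : P.map (fun ω => (m.base ω, m.T ω)) =
    (P.map m.base).prod (Measure.pi fun _ =>
      ν.prod (stdComplexGaussian.prod stdComplexGaussian)) := by
  have h1 := (measurePreserving_arrowProdEquivProdArrow State (ℂ × ℂ) (Fin n) (fun _ => ν)
    (fun _ => stdComplexGaussian.prod stdComplexGaussian)).symm
  have h2 := (measurePreserving_arrowProdEquivProdArrow ℂ ℂ (Fin n) (fun _ => stdComplexGaussian)
    (fun _ => stdComplexGaussian)).symm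
  have h3 := h1.comp ((MeasurePreserving.id (Measure.pi fun _ : Fin n => ν)).prod h2)
  exact map_indep_comp m.measurable_base
    (m.measurable_S.prodMk (m.measurable_N.prodMk m.measurable_N')) m.law (f := id)
    measurable_id h3.measurable h3.map_eq

/-- Delayed knowledge enters here: base and past determine the input at time `t`, and the current
state and noises are independent of them. -/
theorem law_T_apply (t : Fin n) :
    P.map (fun ω => ((m.base ω, pre t (m.T ω)), m.T ω t)) =
      (P.map fun ω => (m.base ω, pre t (m.T ω))).prod
        (ν.prod (stdComplexGaussian.prod stdComplexGaussian)) := by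
  have hp := measurePreserving_pre (ν.prod (stdComplexGaussian.prod stdComplexGaussian)) t
  have h := map_indep_comp m.measurable_base m.measurable_T m.law_T (f := id)
    measurable_id hp.measurable hp.map_eq
  exact map_indep_assoc m.measurable_base ((measurable_pre t).comp m.measurable_T)
    ((measurable_pi_apply t).comp m.measurable_T) h

/-- The input at time `t` as a function of the past. -/
def inputOf (t : Fin n) (x : β × (Fin (t : ℕ) → State × ℂ × ℂ)) : Vec :=
  m.enc t x.1 (fun k => (x.2 k).1)

theorem measurable_inputOf (t : Fin n) : Measurable (m.inputOf t) := by
  have h : Measurable fun x : β × (Fin (t : ℕ) → State × ℂ × ℂ) => (x.1, fun k => (x.2 k).1) := by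
    fun_prop
  exact (m.measurable_enc t).comp h

/-- The past outputs as a function of the past noises and states. -/
noncomputable def outputOf (t : Fin n) (x : β × (Fin (t : ℕ) → State × ℂ × ℂ)) :
    Fin (t : ℕ) → (State × ℂ) × ℂ := fun k =>
  let u : Vec := m.enc (Fin.castLE t.isLt.le k) x.1 (fun j => (x.2 ⟨j, j.2.trans k.2⟩).1)
  (((x.2 k).1, rx (m.r (Fin.castLE t.isLt.le k)) (p (x.2 k).1) u (x.2 k).2.1),
    rx (m.r' (Fin.castLE t.isLt.le k)) (q (x.2 k).1) u (x.2 k).2.2)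

theorem measurable_outputOf (t : Fin n) : Measurable (m.outputOf t) := by
  refine measurable_pi_lambda _ fun k => ?_
  have h1 := m.measurable_p
  have h2 := m.measurable_q
  have hu : Measurable fun x : β × (Fin (t : ℕ) → State × ℂ × ℂ) =>
      m.enc (Fin.castLE t.isLt.le k) x.1 (fun j => (x.2 ⟨j, j.2.trans k.2⟩).1) := by
    have h : Measurable fun x : β × (Fin (t : ℕ) → State × ℂ × ℂ) =>
        (x.1, fun j : Fin (Fin.castLE t.isLt.le k : ℕ) => (x.2 ⟨j, j.2.trans k.2⟩).1) := by
      fun_prop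
    exact (m.measurable_enc (Fin.castLE t.isLt.le k)).comp h
  unfold outputOf
  fun_prop

/-- The outputs of the first receiver are at least half as informative as all the outputs. -/
theorem two_mul_condKL_SY_le {U : β → 𝒰} (hU : Measurable U) {ε B : ℝ} (hB : 0 ≤ B)
    (hgood : 1 - ε ≤ (ν.prod ν).real (goodPairs p q B)) :
    2 * condKL P (fun ω => U (m.base ω)) m.SY (Measure.pi fun t => ν.prod (m.γ t)) +
        ∑ t, ENNReal.ofReal ((1 - ε) * min (Real.log (m.r t ^ 2)) (Real.log (m.r' t ^ 2)) -
          Real.log (1 + B) - 9 * noisePower) ≤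
      condKL P (fun ω => U (m.base ω)) m.SYZ
          (Measure.pi fun t => (ν.prod (m.γ t)).prod (m.γ' t)) +
        ∑ t, ENNReal.ofReal (m.up t) := by
  have hUb : Measurable fun ω => U (m.base ω) := hU.comp m.measurable_base
  rw [condKL_pi hUb m.measurable_SY, condKL_pi hUb m.measurable_SYZ, Finset.mul_sum,
    ← Finset.sum_add_distrib, ← Finset.sum_add_distrib]
  refine Finset.sum_le_sum fun t _ => ?_
  have hV : Measurable fun ω => (U (m.base ω), pre t (m.SYZ ω)) :=
    hUb.prodMk ((measurable_pre t).comp m.measurable_SYZ)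
  have hSYt : Measurable fun ω => m.SY ω t := (measurable_pi_apply t).comp m.measurable_SY
  -- The chain rule for one receiver conditions on its own past only. Adjoining the other receiver's
  -- past increases the divergence and gives both sums the same conditioning.
  have h1 : condKL P (fun ω => (U (m.base ω), pre t (m.SY ω))) (fun ω => m.SY ω t)
      (ν.prod (m.γ t)) ≤ condKL P (fun ω => (U (m.base ω), pre t (m.SYZ ω))) (fun ω => m.SY ω t)
      (ν.prod (m.γ t)) :=
    condKL_comp_left_le (f := fun x => (x.1, fun k => (x.2 k).1)) hV hSYt (by fun_prop)
  refine (add_le_add (mul_le_mul_right h1 2) le_rfl).trans ?_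
  refine two_mul_condKL_le ν m.measurable_p m.measurable_q m.integrable_p m.integrable_q le_rfl hV
    (m.measurable_X_apply t) (m.measurable_S_apply t) (m.measurable_N_apply t)
    (m.measurable_N'_apply t) (fun ω => m.power_X ω t) ?_ (m.one_le_r t) (m.one_le_r' t) hB hgood
  -- Past outputs and current input are functions of base and past triples, so they inherit
  -- independence from the current triple.
  exact map_indep_comp (f := fun x => ((U x.1, m.outputOf t x), m.inputOf t x)) (g := id)
    (m.measurable_base.prodMk ((measurable_pre t).comp m.measurable_T))
    ((measurable_pi_apply t).comp m.measurable_T) (m.law_T_apply t)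
    (((hU.comp measurable_fst).prodMk (m.measurable_outputOf t)).prodMk (m.measurable_inputOf t))
    measurable_id Measure.map_id

end Transmission

/-! ### Mutual information as a divergence. -/

section MutualInformation

variable {Ω 𝒰 𝒱 𝒱' : Type*} [MeasurableSpace Ω] [MeasurableSpace 𝒰] [MeasurableSpace 𝒱]
  [MeasurableSpace 𝒱'] {P : Measure Ω} [IsProbabilityMeasure P]

theorem mutual_comp_le {W : Ω → 𝒰} {V : Ω → 𝒱} {V' : Ω → 𝒱'} (hW : Measurable W)
    (hV : Measurable V) {g : 𝒱 → 𝒱'} (hg : Measurable g) (h : ∀ ω, V' ω = g (V ω)) :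
    klDiv (P.map fun ω => (W ω, V' ω)) ((P.map W).prod (P.map V')) ≤
      klDiv (P.map fun ω => (W ω, V ω)) ((P.map W).prod (P.map V)) := by
  obtain rfl : V' = fun ω => g (V ω) := funext h
  have := Measure.isProbabilityMeasure_map (μ := P) hV.aemeasurable
  exact condKL_comp_right_le hW hV hg (Measure.map_map hg hV)

theorem mutual_comm {W : Ω → 𝒰} {V : Ω → 𝒱} (hW : Measurable W) (hV : Measurable V) :
    klDiv (P.map fun ω => (W ω, V ω)) ((P.map W).prod (P.map V)) =
      klDiv (P.map fun ω => (V ω, W ω)) ((P.map V).prod (P.map W)) := by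
  have := Measure.isProbabilityMeasure_map (μ := P) hW.aemeasurable
  have := Measure.isProbabilityMeasure_map (μ := P) hV.aemeasurable
  have := Measure.isProbabilityMeasure_map (μ := P) (hW.prodMk hV).aemeasurable
  rw [← klDiv_map_measurableEquiv (P.map fun ω => (W ω, V ω)) _ MeasurableEquiv.prodComm,
    Measure.map_map (MeasurableEquiv.measurable _) (hW.prodMk hV)]
  have h : ((P.map W).prod (P.map V)).map MeasurableEquiv.prodComm = (P.map V).prod (P.map W) :=
    Measure.prod_swap
  rw [h]
  rfl

/-- If `V` reveals little about `W` and determines the uniform message `W'`, then `V` and `W'`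
together reveal little about `W`. -/
theorem mutual_pair_add_le {M M' : ℕ} (hM : 0 < M) (hM' : 0 < M') {W : Ω → Fin M} {W' : Ω → Fin M'}
    {V : Ω → 𝒱} (hW : Measurable W) (hW' : Measurable W') (hV : Measurable V)
    (hlaw' : P.map W' = uniformOn Set.univ) :
    klDiv (P.map fun ω => (W ω, (W' ω, V ω))) ((P.map W).prod (P.map fun ω => (W' ω, V ω))) +
      klDiv (P.map fun ω => (W' ω, V ω)) ((P.map W').prod (P.map V)) ≤
      klDiv (P.map fun ω => (W ω, V ω)) ((P.map W).prod (P.map V)) +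
        ENNReal.ofReal (Real.log M') := by
  have : Nonempty (Fin M) := ⟨⟨0, hM⟩⟩
  have : Nonempty (Fin M') := ⟨⟨0, hM'⟩⟩
  have := Measure.isProbabilityMeasure_map (μ := P) hV.aemeasurable
  have := Measure.isProbabilityMeasure_map (μ := P) hW'.aemeasurable
  -- D(V,W'|W) from P_V × P_W' is expanded in two ways: as I(W;V,W') + I(V;W'), and as I(W;V) plus a
  -- divergence from the uniform law, which is at most log M'.
  have h1 := condKL_chain (P := P) (r := P.map V) (q := P.map W') hW hV hW'
  have h2 := condKL_eq_klDiv_add (P := P) (r := (P.map V).prod (P.map W')) (hV.prodMk hW') hW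
  have h3 := condKL_uniformOn_le (P := P) hM' hW' (hW.prodMk hV)
  rw [← hlaw'] at h3
  have h4 := mutual_comp_le (P := P) (W := W) (V := fun ω => (V ω, W' ω))
    (V' := fun ω => (W' ω, V ω)) hW (by fun_prop) measurable_swap (fun _ => rfl)
  calc _ ≤ klDiv (P.map fun ω => (W ω, (V ω, W' ω)))
        ((P.map W).prod (P.map fun ω => (V ω, W' ω))) +
      klDiv (P.map fun ω => (V ω, W' ω)) ((P.map V).prod (P.map W')) :=
        add_le_add h4 (mutual_comm hW' hV).le
    _ = condKL P W V (P.map V) + condKL P (fun ω => (W ω, V ω)) W' (P.map W') := by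
        rw [add_comm, ← h2, h1]
    _ ≤ _ := add_le_add le_rfl h3

end MutualInformation

namespace Transmission

variable {Ω β 𝒰 𝒱 : Type*} [MeasurableSpace Ω] [MeasurableSpace β] [MeasurableSpace 𝒰]
  [MeasurableSpace 𝒱] {P : Measure Ω} [IsProbabilityMeasure P]
  {ν : Measure State} [IsProbabilityMeasure ν] {p q : State → Vec} {n : ℕ}

/-! ### Divergence bounds for whole blocks. -/

section General

variable (m : Transmission (β := β) P ν p q n)

theorem law_S_apply (t : Fin n) : P.map (fun ω => m.S ω t) = ν := by
  have hm : Measurable fun ω => (m.base ω, pre t (m.T ω)) :=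
    m.measurable_base.prodMk ((measurable_pre t).comp m.measurable_T)
  have hT : Measurable fun ω => m.T ω t := (measurable_pi_apply t).comp m.measurable_T
  have := Measure.isProbabilityMeasure_map (μ := P) hm.aemeasurable
  have h := congrArg Measure.snd (m.law_T_apply t)
  rw [Measure.snd_map_prodMk hm, Measure.snd_prod] at h
  rw [show (fun ω => m.S ω t) = Prod.fst ∘ fun ω => m.T ω t from rfl,
    ← Measure.map_map measurable_fst hT, h, measurePreserving_fst.map_eq]

theorem integrable_p_S (t : Fin n) : Integrable (fun ω => ∑ i, ‖p (m.S ω t) i‖ ^ 2) P := by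
  have h := m.integrable_p
  rw [← m.law_S_apply t] at h
  exact h.comp_measurable (m.measurable_S_apply t)

theorem integral_p_S (t : Fin n) :
    ∫ ω, ∑ i, ‖p (m.S ω t) i‖ ^ 2 ∂P = ∫ s, ∑ i, ‖p s i‖ ^ 2 ∂ν := by
  have hp := m.measurable_p
  conv_rhs => rw [← m.law_S_apply t]
  rw [integral_map (m.measurable_S_apply t).aemeasurable (by fun_prop)]

theorem law_noise : P.map (fun ω => ((m.base ω, (m.S ω, m.N' ω)), m.N ω)) =
    (P.map fun ω => (m.base ω, (m.S ω, m.N' ω))).prod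
      (Measure.pi fun _ => stdComplexGaussian) := by
  have hg := (measurePreserving_prodAssoc (Measure.pi fun _ : Fin n => ν)
    (Measure.pi fun _ : Fin n => stdComplexGaussian)
    (Measure.pi fun _ : Fin n => stdComplexGaussian)).symm.comp
    ((MeasurePreserving.id _).prod Measure.measurePreserving_swap)
  have h := map_indep_comp m.measurable_base
    (m.measurable_S.prodMk (m.measurable_N.prodMk m.measurable_N')) m.law (f := id)
    measurable_id hg.measurable hg.map_eq
  exact map_indep_assoc m.measurable_base (m.measurable_S.prodMk m.measurable_N') m.measurable_N h

/-- The output of the first receiver is limited by its noise, given everything else. -/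
theorem condKL_Y_le {g : β × (Fin n → State) × (Fin n → ℂ) → 𝒰} (hg : Measurable g) :
    condKL P (fun ω => g (m.base ω, (m.S ω, m.N' ω))) m.Y (Measure.pi m.γ) ≤
      ∑ t, ENNReal.ofReal (m.up t) := by
  have hc : Measurable fun ω => (m.base ω, (m.S ω, m.N' ω)) :=
    m.measurable_base.prodMk (m.measurable_S.prodMk m.measurable_N')
  refine (condKL_comp_left_le hc m.measurable_Y hg).trans ?_
  rw [condKL_pi hc m.measurable_Y]
  refine Finset.sum_le_sum fun t _ => ?_
  have hcN : Measurable fun ω => ((m.base ω, (m.S ω, m.N' ω)), pre t (m.N ω)) :=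
    hc.prodMk ((measurable_pre t).comp m.measurable_N)
  -- Given base, all states and the other noise, past outputs are functions of past noises.
  -- Conditioning on these noises instead raises the divergence and keeps the current noise
  -- independent.
  have hf : Measurable fun x : (β × (Fin n → State) × (Fin n → ℂ)) × (Fin (t : ℕ) → ℂ) =>
      (x.1, fun k : Fin (t : ℕ) => rx (m.r (Fin.castLE t.isLt.le k))
        (p (x.1.2.1 (Fin.castLE t.isLt.le k)))
        (m.enc (Fin.castLE t.isLt.le k) x.1.1 (pre (Fin.castLE t.isLt.le k) x.1.2.1)) (x.2 k)) := by
    refine measurable_fst.prodMk (measurable_pi_lambda _ fun k => ?_)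
    have h1 := m.measurable_p
    have h2 : Measurable fun x : (β × (Fin n → State) × (Fin n → ℂ)) × (Fin (t : ℕ) → ℂ) =>
        m.enc (Fin.castLE t.isLt.le k) x.1.1 (pre (Fin.castLE t.isLt.le k) x.1.2.1) :=
      (m.measurable_enc (Fin.castLE t.isLt.le k)).comp ((measurable_fst.comp measurable_fst).prodMk
        ((measurable_pre _).comp (by fun_prop)))
    fun_prop
  have h1 := condKL_comp_left_le (P := P) (r := m.γ t) hcN (m.measurable_Y_apply t) hf
  refine le_trans h1 ?_
  have hind : P.map (fun ω => (((m.base ω, (m.S ω, m.N' ω)), pre t (m.N ω)), m.N ω t)) =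
      (P.map fun ω => ((m.base ω, (m.S ω, m.N' ω)), pre t (m.N ω))).prod stdComplexGaussian := by
    have hp := measurePreserving_pre stdComplexGaussian t
    have h := map_indep_comp hc m.measurable_N m.law_noise (f := id)
      measurable_id hp.measurable hp.map_eq
    exact map_indep_assoc hc ((measurable_pre t).comp m.measurable_N) (m.measurable_N_apply t) h
  have hpm : Measurable fun u : (β × (Fin n → State) × (Fin n → ℂ)) × (Fin (t : ℕ) → ℂ) =>
      p (u.1.2.1 t) := m.measurable_p.comp (by fun_prop)
  have hxm : Measurable fun u : (β × (Fin n → State) × (Fin n → ℂ)) × (Fin (t : ℕ) → ℂ) =>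
      m.enc t u.1.1 (pre t u.1.2.1) :=
    (m.measurable_enc t).comp ((measurable_fst.comp measurable_fst).prodMk
        ((measurable_pre _).comp (by fun_prop)))
  exact condKL_rx_le hcN (m.measurable_N_apply t) hind hpm hxm (m.one_le_r t) (fun ω => rfl)
    (fun u => m.power _ _ _) (m.integrable_p_S t) (m.integral_p_S t).le

/-- Per-letter bound for the state and output at the first receiver. -/
theorem condKL_SY_apply_le {U : β → 𝒰} (hU : Measurable U) (t : Fin n) :
    condKL P (fun ω => (U (m.base ω), pre t (m.SY ω))) (fun ω => m.SY ω t) (ν.prod (m.γ t)) ≤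
      ENNReal.ofReal (m.up t) := by
  have hc : Measurable fun ω => (m.base ω, pre t (m.T ω)) :=
    m.measurable_base.prodMk ((measurable_pre t).comp m.measurable_T)
  have hT : Measurable fun ω => m.T ω t := (measurable_pi_apply t).comp m.measurable_T
  have hSYt : Measurable fun ω => m.SY ω t := (measurable_pi_apply t).comp m.measurable_SY
  have h1 := condKL_comp_left_le (P := P) (r := ν.prod (m.γ t)) hc hSYt
    (f := fun x => (U x.1, fun k => (m.outputOf t x k).1))
    ((hU.comp measurable_fst).prodMk (measurable_pi_lambda _ fun k =>
      ((measurable_pi_apply k).comp (m.measurable_outputOf t)).fst))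
  refine le_trans h1 ?_
  have h2 := condKL_chain (P := P) (r := ν) (q := m.γ t) hc (m.measurable_S_apply t)
    (m.measurable_Y_apply t)
  refine h2.le.trans ?_
  -- The current state is independent of the past with its reference law, so it contributes nothing;
  -- only the output is charged.
  have e1 : P.map (fun ω => ((m.base ω, pre t (m.T ω)), m.S ω t)) =
      (P.map fun ω => (m.base ω, pre t (m.T ω))).prod ν :=
    map_indep_comp hc hT (m.law_T_apply t) (f := id) measurable_id measurable_fst
      measurePreserving_fst.map_eq
  rw [condKL_eq_zero e1, zero_add]
  have hg := (MeasurePreserving.id ν).prod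
    (measurePreserving_fst (μ := stdComplexGaussian) (ν := stdComplexGaussian))
  have e2 := map_indep_comp hc hT (m.law_T_apply t) (f := id) measurable_id hg.measurable hg.map_eq
  have e3 : P.map (fun ω => (((m.base ω, pre t (m.T ω)), m.S ω t), m.N ω t)) =
      (P.map fun ω => ((m.base ω, pre t (m.T ω)), m.S ω t)).prod stdComplexGaussian :=
    map_indep_assoc hc (m.measurable_S_apply t) (m.measurable_N_apply t) e2
  have hpm : Measurable fun u : (β × (Fin (t : ℕ) → State × ℂ × ℂ)) × State => p u.2 :=
    m.measurable_p.comp measurable_snd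
  have hxm : Measurable fun u : (β × (Fin (t : ℕ) → State × ℂ × ℂ)) × State =>
      m.inputOf t u.1 := (m.measurable_inputOf t).comp measurable_fst
  exact condKL_rx_le (hc.prodMk (m.measurable_S_apply t)) (m.measurable_N_apply t) e3 hpm hxm
    (m.one_le_r t) (fun ω => rfl) (fun u => m.power _ _ _) (m.integrable_p_S t)
    (m.integral_p_S t).le

/-- Finiteness is what permits subtracting these extended quantities in `combine_bounds`. -/
theorem condKL_SY_ne_top {U : β → 𝒰} (hU : Measurable U) :
    condKL P (fun ω => U (m.base ω)) m.SY (Measure.pi fun t => ν.prod (m.γ t)) ≠ ∞ := by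
  have hUb : Measurable fun ω => U (m.base ω) := hU.comp m.measurable_base
  rw [condKL_pi hUb m.measurable_SY]
  exact ENNReal.sum_ne_top.2 fun t _ =>
    ne_top_of_le_ne_top ENNReal.ofReal_ne_top (m.condKL_SY_apply_le hU t)

/-- Adding the output of the second receiver costs no more than its strength. -/
theorem condKL_SYZ_le {U : β → 𝒰} (hU : Measurable U) :
    condKL P (fun ω => U (m.base ω)) m.SYZ (Measure.pi fun t => (ν.prod (m.γ t)).prod (m.γ' t)) ≤
      condKL P (fun ω => U (m.base ω)) m.SZ (Measure.pi fun t => ν.prod (m.γ' t)) +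
        ∑ t, ENNReal.ofReal (m.up t) := by
  have hUb : Measurable fun ω => U (m.base ω) := hU.comp m.measurable_base
  -- The letters ((S,Y),Z) are regrouped into the block of all (S,Z) followed by the block of all Y,
  -- so that the chain rule isolates the output of the first receiver.
  have h1 := (measurePreserving_pi (fun t => (ν.prod (m.γ' t)).prod (m.γ t))
    (fun t => (ν.prod (m.γ t)).prod (m.γ' t))
    (fun t => measurePreserving_prod_right_comm ν (m.γ' t) (m.γ t))).comp
    (measurePreserving_arrowProdEquivProdArrow (State × ℂ) ℂ (Fin n)
      (fun t => ν.prod (m.γ' t)) m.γ).symm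
  have h2 := condKL_comp_right_le (P := P) hUb (m.measurable_SZ.prodMk m.measurable_Y)
    h1.measurable h1.map_eq
  refine le_trans h2 ?_
  rw [condKL_chain hUb m.measurable_SZ m.measurable_Y]
  refine add_le_add le_rfl ?_
  have hg : Measurable fun x : β × (Fin n → State) × (Fin n → ℂ) => (U x.1, fun t : Fin n =>
      (x.2.1 t, rx (m.r' t) (q (x.2.1 t)) (m.enc t x.1 (pre t x.2.1)) (x.2.2 t))) := by
    refine (hU.comp measurable_fst).prodMk (measurable_pi_lambda _ fun t => ?_)
    have h1 := m.measurable_q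
    have h2 : Measurable fun x : β × (Fin n → State) × (Fin n → ℂ) =>
        m.enc t x.1 (pre t x.2.1) :=
      (m.measurable_enc t).comp (measurable_fst.prodMk ((measurable_pre _).comp (by fun_prop)))
    fun_prop
  exact m.condKL_Y_le hg

theorem condKL_swap_SYZ_le {U : β → 𝒰} (hU : Measurable U) :
    condKL P (fun ω => U (m.base ω)) m.swap.SYZ
        (Measure.pi fun t => (ν.prod (m.γ' t)).prod (m.γ t)) ≤
      condKL P (fun ω => U (m.base ω)) m.SYZ
        (Measure.pi fun t => (ν.prod (m.γ t)).prod (m.γ' t)) := by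
  have h1 := measurePreserving_pi (fun t => (ν.prod (m.γ t)).prod (m.γ' t))
    (fun t => (ν.prod (m.γ' t)).prod (m.γ t))
    (fun t => measurePreserving_prod_right_comm ν (m.γ t) (m.γ' t))
  exact condKL_comp_right_le (P := P) (hU.comp m.measurable_base) m.measurable_SYZ
    h1.measurable h1.map_eq

/-- The observation of the first receiver as a function of its outputs and all states. -/
def viewOf (p q : State → Vec) (x : Fin n → State × ℂ) : View n :=
  (fun t => (x t).2, fun t => p (x t).1, fun t => q (x (Fin.castLE (Nat.sub_le n 1) t)).1)

theorem measurable_viewOf (hp : Measurable p) (hq : Measurable q) :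
    Measurable (viewOf (n := n) p q) := by
  unfold viewOf
  fun_prop

theorem mutual_view_le {W : Ω → 𝒰} (hW : Measurable W) :
    klDiv (P.map fun ω => (W ω, m.view ω)) ((P.map W).prod (P.map m.view)) ≤
      klDiv (P.map fun ω => (W ω, m.SY ω)) ((P.map W).prod (P.map m.SY)) :=
  mutual_comp_le hW m.measurable_SY (measurable_viewOf m.measurable_p m.measurable_q)
    fun _ => rfl

end General

/-! ### The last time instant, where a receiver lacks the other's channel vector. -/

section LastLetter

variable (m : Transmission (β := β) P ν p q (n + 1))

/-- States and outputs at the first receiver without those at the last time. -/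
noncomputable def initSY (ω : Ω) (k : Fin n) : State × ℂ := m.SY ω k.castSucc

theorem measurable_initSY : Measurable m.initSY :=
  measurable_pi_lambda _ fun _ => (measurable_pi_apply _).comp m.measurable_SY

/-- All states and outputs but the last as a function of the observation. -/
def initOf (x : View (n + 1)) (k : Fin n) : State × ℂ :=
  (m.join (x.2.1 k.castSucc) (x.2.2 k), x.1 k.castSucc)

theorem measurable_initOf : Measurable m.initOf := by
  refine measurable_pi_lambda _ fun k => ?_
  have h : Measurable fun x : View (n + 1) => (x.2.1 k.castSucc, x.2.2 k) :=
    ((measurable_pi_apply k.castSucc).comp (measurable_fst.comp measurable_snd)).prodMk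
      ((measurable_pi_apply (X := fun _ : Fin (n + 1 - 1) => Vec) k).comp
        (measurable_snd.comp measurable_snd))
  exact (m.measurable_join.comp h).prodMk ((measurable_pi_apply _).comp measurable_fst)

/-- The view misses only the other receiver's last channel vector, so it determines every state but
the last. Leakage through the view thus controls leakage through these letters. -/
theorem initSY_eq (ω : Ω) : m.initSY ω = m.initOf (m.view ω) := by
  funext k
  exact Prod.ext (m.join_eq _).symm rfl

/-- Restoring the last letter costs one per-letter bound, of order log ρ, which disappears after
division by the block length. -/
theorem condKL_SY_le_initSY {U : β → 𝒰} (hU : Measurable U) :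
    condKL P (fun ω => U (m.base ω)) m.SY (Measure.pi fun t => ν.prod (m.γ t)) ≤
      condKL P (fun ω => U (m.base ω)) m.initSY
        (Measure.pi fun k : Fin n => ν.prod (m.γ k.castSucc)) +
        ENNReal.ofReal (m.up (Fin.last n)) := by
  have hUb : Measurable fun ω => U (m.base ω) := hU.comp m.measurable_base
  rw [condKL_pi_succ hUb m.measurable_SY]
  exact add_le_add le_rfl (m.condKL_SY_apply_le hU (Fin.last n))

theorem map_initSY_le :
    klDiv (P.map m.initSY) (Measure.pi fun k : Fin n => ν.prod (m.γ k.castSucc)) ≤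
      klDiv (P.map m.SY) (Measure.pi fun t => ν.prod (m.γ t)) := by
  have := Measure.isProbabilityMeasure_map (μ := P) m.measurable_SY.aemeasurable
  have hmp := measurePreserving_fst.comp
    (measurePreserving_init_last fun t => ν.prod (m.γ t))
  have h := klDiv_map_le (P.map m.SY) (Measure.pi fun t => ν.prod (m.γ t)) hmp.measurable
  rw [hmp.map_eq, Measure.map_map hmp.measurable m.measurable_SY] at h
  exact h

theorem condKL_initSY_le {U : β → 𝒰} (hU : Measurable U) :
    condKL P (fun ω => U (m.base ω)) m.initSY
        (Measure.pi fun k : Fin n => ν.prod (m.γ k.castSucc)) ≤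
      condKL P (fun ω => U (m.base ω)) m.SY (Measure.pi fun t => ν.prod (m.γ t)) := by
  have hmp := measurePreserving_fst.comp
    (measurePreserving_init_last fun t => ν.prod (m.γ t))
  exact condKL_comp_right_le (hU.comp m.measurable_base) m.measurable_SY hmp.measurable hmp.map_eq

end LastLetter

end Transmission

/-! ### The outer bound at finite block length. -/

namespace Transmission

variable {Ω β 𝒰 : Type*} [MeasurableSpace Ω] [MeasurableSpace β] [MeasurableSpace 𝒰]
  {P : Measure Ω} [IsProbabilityMeasure P]
  {ν : Measure State} [IsProbabilityMeasure ν] {p q : State → Vec} {n : ℕ}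

theorem fano_view (m : Transmission (β := β) P ν p q n) {M : ℕ} (hM : 0 < M) {W : β → Fin M}
    (hW : Measurable W) (hlaw : P.map (fun ω => W (m.base ω)) = uniformOn Set.univ)
    {dec : View n → Fin M} (hdec : Measurable dec) :
    ENNReal.ofReal ((1 - P.real {ω | dec (m.view ω) ≠ W (m.base ω)}) * Real.log M - Real.log 2) ≤
      klDiv (P.map fun ω => (W (m.base ω), m.view ω))
        ((P.map fun ω => W (m.base ω)).prod (P.map m.view)) :=
  fano_le hM (hW.comp m.measurable_base) m.measurable_view hlaw hdec

/-- The information about a message in the outputs of a receiver, in terms of divergences. -/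
theorem klDiv_SY_add_mutual_le (m : Transmission (β := β) P ν p q n) {M : ℕ} (hM : 0 < M)
    {W : β → Fin M} (hW : Measurable W) :
    klDiv (P.map m.SY) (Measure.pi fun t => ν.prod (m.γ t)) +
        klDiv (P.map fun ω => (W (m.base ω), m.view ω))
          ((P.map fun ω => W (m.base ω)).prod (P.map m.view)) ≤
      condKL P (fun ω => W (m.base ω)) m.SY (Measure.pi fun t => ν.prod (m.γ t)) := by
  have : Nonempty (Fin M) := ⟨⟨0, hM⟩⟩
  have hWb : Measurable fun ω => W (m.base ω) := hW.comp m.measurable_base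
  rw [condKL_eq_klDiv_add m.measurable_SY hWb]
  exact add_le_add le_rfl (m.mutual_view_le hWb)

/-- If the observation of a receiver contains little information about a message, then its outputs
have nearly the same divergence given the message. -/
theorem condKL_SY_le_add_mutual (m : Transmission (β := β) P ν p q (n + 1)) {M : ℕ} (hM : 0 < M)
    {W : β → Fin M} (hW : Measurable W) :
    condKL P (fun ω => W (m.base ω)) m.SY (Measure.pi fun t => ν.prod (m.γ t)) ≤
      klDiv (P.map m.SY) (Measure.pi fun t => ν.prod (m.γ t)) +
        klDiv (P.map fun ω => (W (m.base ω), m.view ω))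
          ((P.map fun ω => W (m.base ω)).prod (P.map m.view)) +
        ENNReal.ofReal (m.up (Fin.last n)) := by
  have : Nonempty (Fin M) := ⟨⟨0, hM⟩⟩
  have hWb : Measurable fun ω => W (m.base ω) := hW.comp m.measurable_base
  refine (m.condKL_SY_le_initSY hW).trans ?_
  rw [condKL_eq_klDiv_add m.measurable_initSY hWb]
  exact add_le_add (add_le_add m.map_initSY_le
    (mutual_comp_le hWb m.measurable_view m.measurable_initOf m.initSY_eq)) le_rfl

/-- As the messages are independent, conditioning on `W` besides `W'` raises the divergence by I(W;
W', all outputs), which is at least the information on `W` in the first receiver's view. -/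
theorem condKL_pair_SYZ_ge (m : Transmission (β := β) P ν p q n) {M M' : ℕ} (hM : 0 < M)
    {W : β → Fin M} (hW : Measurable W) {W' : β → Fin M'} (hW' : Measurable W')
    (hind : P.map (fun ω => (W (m.base ω), W' (m.base ω))) =
      (P.map fun ω => W (m.base ω)).prod (P.map fun ω => W' (m.base ω))) :
    condKL P (fun ω => W' (m.base ω)) m.SYZ
          (Measure.pi fun t => (ν.prod (m.γ t)).prod (m.γ' t)) +
        klDiv (P.map fun ω => (W (m.base ω), m.view ω))
          ((P.map fun ω => W (m.base ω)).prod (P.map m.view)) ≤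
      condKL P (fun ω => (W (m.base ω), W' (m.base ω))) m.SYZ
          (Measure.pi fun t => (ν.prod (m.γ t)).prod (m.γ' t)) := by
  have : Nonempty (Fin M) := ⟨⟨0, hM⟩⟩
  have hWb : Measurable fun ω => W (m.base ω) := hW.comp m.measurable_base
  have hWb' : Measurable fun ω => W' (m.base ω) := hW'.comp m.measurable_base
  rw [condKL_prod_left hWb' m.measurable_SYZ hWb hind]
  refine add_le_add le_rfl (mutual_comp_le (g := fun x => viewOf p q fun t => (x.2 t).1) hWb
    (hWb'.prodMk m.measurable_SYZ) ?_ fun _ => rfl)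
  exact (measurable_viewOf m.measurable_p m.measurable_q).comp (by fun_prop)

/-- If the observation of a receiver determines `W'` but contains little information about `W`,
then its outputs have nearly the same divergence given both as given `W'` alone. -/
theorem condKL_pair_SY_le (m : Transmission (β := β) P ν p q (n + 1)) {M M' : ℕ} (hM : 0 < M)
    (hM' : 0 < M') {W : β → Fin M} (hW : Measurable W) {W' : β → Fin M'} (hW' : Measurable W')
    (hind : P.map (fun ω => (W (m.base ω), W' (m.base ω))) =
      (P.map fun ω => W (m.base ω)).prod (P.map fun ω => W' (m.base ω)))
    (hlaw' : P.map (fun ω => W' (m.base ω)) = uniformOn Set.univ) :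
    condKL P (fun ω => (W (m.base ω), W' (m.base ω))) m.SY
          (Measure.pi fun t => ν.prod (m.γ t)) +
        klDiv (P.map fun ω => (W' (m.base ω), m.view ω))
          ((P.map fun ω => W' (m.base ω)).prod (P.map m.view)) ≤
      condKL P (fun ω => W' (m.base ω)) m.SY (Measure.pi fun t => ν.prod (m.γ t)) +
        (klDiv (P.map fun ω => (W (m.base ω), m.view ω))
          ((P.map fun ω => W (m.base ω)).prod (P.map m.view)) + ENNReal.ofReal (Real.log M')) +
        ENNReal.ofReal (m.up (Fin.last n)) := by
  have : Nonempty (Fin M) := ⟨⟨0, hM⟩⟩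
  have hWb : Measurable fun ω => W (m.base ω) := hW.comp m.measurable_base
  have hWb' : Measurable fun ω => W' (m.base ω) := hW'.comp m.measurable_base
  have h1 := m.condKL_SY_le_initSY (hW.prodMk hW')
  rw [condKL_prod_left hWb' m.measurable_initSY hWb hind] at h1
  have h2 := mutual_comp_le (P := P) (W := fun ω => W (m.base ω))
    (V := fun ω => (W' (m.base ω), m.view ω)) (V' := fun ω => (W' (m.base ω), m.initSY ω))
    (g := Prod.map id m.initOf) hWb (hWb'.prodMk m.measurable_view)
    (measurable_id.prodMap m.measurable_initOf) (fun ω => by rw [m.initSY_eq]; rfl)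
  have h3 := mutual_pair_add_le hM hM' hWb hWb' m.measurable_view hlaw'
  have h4 := m.condKL_initSY_le hW'
  calc _ ≤ condKL P (fun ω => W' (m.base ω)) m.SY (Measure.pi fun t => ν.prod (m.γ t)) +
        klDiv (P.map fun ω => (W (m.base ω), (W' (m.base ω), m.view ω)))
          ((P.map fun ω => W (m.base ω)).prod (P.map fun ω => (W' (m.base ω), m.view ω))) +
        ENNReal.ofReal (m.up (Fin.last n)) + _ := by
          refine add_le_add (h1.trans ?_) le_rfl
          exact add_le_add (add_le_add h4 h2) le_rfl
    _ = condKL P (fun ω => W' (m.base ω)) m.SY (Measure.pi fun t => ν.prod (m.γ t)) +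
        (klDiv (P.map fun ω => (W (m.base ω), (W' (m.base ω), m.view ω)))
          ((P.map fun ω => W (m.base ω)).prod (P.map fun ω => (W' (m.base ω), m.view ω))) +
          klDiv (P.map fun ω => (W' (m.base ω), m.view ω))
          ((P.map fun ω => W' (m.base ω)).prod (P.map m.view))) +
        ENNReal.ofReal (m.up (Fin.last n)) := by
          ring
    _ ≤ _ := by gcongr

/-- Per-letter lower bound. -/
noncomputable def low (m : Transmission (β := β) P ν p q n) (ε B : ℝ) (t : Fin n) : ℝ :=
  (1 - ε) * min (Real.log (m.r t ^ 2)) (Real.log (m.r' t ^ 2)) - Real.log (1 + B) - 9 * noisePower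

theorem toReal_sum_ofReal_le {ι : Type*} (s : Finset ι) (f : ι → ℝ) :
    ∑ i ∈ s, f i ≤ (∑ i ∈ s, ENNReal.ofReal (f i)).toReal := by
  rw [ENNReal.toReal_sum fun _ _ => ENNReal.ofReal_ne_top]
  exact Finset.sum_le_sum fun i _ => by rw [ENNReal.toReal_ofReal']; exact le_max_left _ _

theorem toReal_sum_ofReal {ι : Type*} (s : Finset ι) {f : ι → ℝ} (hf : ∀ i, 0 ≤ f i) :
    (∑ i ∈ s, ENNReal.ofReal (f i)).toReal = ∑ i ∈ s, f i := by
  rw [ENNReal.toReal_sum fun _ _ => ENNReal.ofReal_ne_top]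
  exact Finset.sum_congr rfl fun i _ => ENNReal.toReal_ofReal (hf i)

/-- The linear elimination behind `rate_bound`. The `x`s are divergences given `W`; `k₀`, `k` are
those of the two receivers without a message; `y`, `y₃` are given both messages and `y₂`, `y₄`, `y₅`
given `W'`. Taking `a1` twice and every other inequality once cancels all of them except `k₀`, which
is nonnegative. -/
theorem combine_bounds {x₁ x₂ x₃ k₀ k y y₂ y₃ y₄ y₅ i i' l g g' u u' c d : ℝ≥0∞}
    (a1 : k₀ + i ≤ x₁) (a2 : 2 * x₁ + g ≤ x₂ + u) (a3 : x₂ ≤ x₃ + u) (a4 : x₃ ≤ k + l + c)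
    (a5 : y₂ + i ≤ y) (a6 : y ≤ y₃ + u) (a7 : y₃ + i' ≤ y₄ + (l + d) + c)
    (a8 : 2 * y₄ + g' ≤ y₅ + u') (a8' : y₅ ≤ y₂) (a9 : k + i' ≤ y₄) (hu : u ≠ ∞) (hu' : u' ≠ ∞)
    (hx₁ : x₁ ≠ ∞) (hx₃ : x₃ ≠ ∞) (hy₃ : y₃ ≠ ∞) (hy₄ : y₄ ≠ ∞) (hl : l ≠ ∞) (hc : c ≠ ∞)
    (hd : d ≠ ∞) :
    i ≠ ∞ ∧ i' ≠ ∞ ∧ g ≠ ∞ ∧ g' ≠ ∞ ∧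
      3 * i.toReal + 2 * i'.toReal + g.toReal + g'.toReal ≤
        3 * u.toReal + u'.toReal + 2 * l.toReal + d.toReal + 2 * c.toReal := by
  have hx₂ : x₂ ≠ ∞ := ne_top_of_le_ne_top (ENNReal.add_ne_top.2 ⟨hx₃, hu⟩) a3
  have hy : y ≠ ∞ := ne_top_of_le_ne_top (ENNReal.add_ne_top.2 ⟨hy₃, hu⟩) a6
  have h5 := ENNReal.add_ne_top.1 (ne_top_of_le_ne_top hy a5)
  have hy₅ : y₅ ≠ ∞ := ne_top_of_le_ne_top h5.1 a8'
  have hg := (ENNReal.add_ne_top.1 (ne_top_of_le_ne_top (ENNReal.add_ne_top.2 ⟨hx₂, hu⟩) a2)).2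
  have hg' := (ENNReal.add_ne_top.1 (ne_top_of_le_ne_top (ENNReal.add_ne_top.2 ⟨hy₅, hu'⟩) a8)).2
  have h9 := ENNReal.add_ne_top.1 (ne_top_of_le_ne_top hy₄ a9)
  have h1 := ENNReal.add_ne_top.1 (ne_top_of_le_ne_top hx₁ a1)
  refine ⟨h5.2, h9.2, hg, hg', ?_⟩
  have hy₂ := h5.1
  have hi := h5.2
  obtain ⟨hk, hi'⟩ := h9
  have hk₀ := h1.1
  lift x₁ to ℝ≥0 using hx₁
  lift x₂ to ℝ≥0 using hx₂
  lift x₃ to ℝ≥0 using hx₃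
  lift k₀ to ℝ≥0 using hk₀
  lift k to ℝ≥0 using hk
  lift y to ℝ≥0 using hy
  lift y₂ to ℝ≥0 using hy₂
  lift y₃ to ℝ≥0 using hy₃
  lift y₄ to ℝ≥0 using hy₄
  lift y₅ to ℝ≥0 using hy₅
  lift i to ℝ≥0 using hi
  lift i' to ℝ≥0 using hi'
  lift l to ℝ≥0 using hl
  lift g to ℝ≥0 using hg
  lift g' to ℝ≥0 using hg'
  lift u to ℝ≥0 using hu
  lift u' to ℝ≥0 using hu'
  lift c to ℝ≥0 using hc
  lift d to ℝ≥0 using hd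
  have b0 := k₀.coe_nonneg
  have b1 : (k₀ + i : ℝ) ≤ x₁ := by exact_mod_cast a1
  have b2 : (2 * x₁ + g : ℝ) ≤ x₂ + u := by exact_mod_cast a2
  have b3 : (x₂ : ℝ) ≤ x₃ + u := by exact_mod_cast a3
  have b4 : (x₃ : ℝ) ≤ k + l + c := by exact_mod_cast a4
  have b5 : (y₂ + i : ℝ) ≤ y := by exact_mod_cast a5
  have b6 : (y : ℝ) ≤ y₃ + u := by exact_mod_cast a6
  have b7 : (y₃ + i' : ℝ) ≤ y₄ + (l + d) + c := by exact_mod_cast a7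
  have b8 : (2 * y₄ + g' : ℝ) ≤ y₅ + u' := by exact_mod_cast a8
  have b8' : (y₅ : ℝ) ≤ y₂ := by exact_mod_cast a8'
  have b9 : (k + i' : ℝ) ≤ y₄ := by exact_mod_cast a9
  simp only [ENNReal.coe_toReal]
  linarith

/-- The outer bound for a code of finite block length. -/
theorem rate_bound (m : Transmission (β := β) P ν p q (n + 1)) {M M' : ℕ} (hM : 0 < M)
    (hM' : 0 < M') {W : β → Fin M} (hW : Measurable W) {W' : β → Fin M'} (hW' : Measurable W')
    (hlaw : P.map (fun ω => W (m.base ω)) = uniformOn Set.univ)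
    (hlaw' : P.map (fun ω => W' (m.base ω)) = uniformOn Set.univ)
    (hind : P.map (fun ω => (W (m.base ω), W' (m.base ω))) =
      (P.map fun ω => W (m.base ω)).prod (P.map fun ω => W' (m.base ω)))
    {dec : View (n + 1) → Fin M} (hdec : Measurable dec)
    {dec' : View (n + 1) → Fin M'} (hdec' : Measurable dec') {ε B : ℝ} (hB : 0 ≤ B)
    (hgood : 1 - ε ≤ (ν.prod ν).real (goodPairs p q B))
    (hgood' : 1 - ε ≤ (ν.prod ν).real (goodPairs q p B)) {l : ℝ≥0∞} (hl : l ≠ ∞)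
    (hleak : klDiv (P.map fun ω => (W (m.base ω), m.swap.view ω))
        ((P.map fun ω => W (m.base ω)).prod (P.map m.swap.view)) ≤ l) :
    3 * ((1 - P.real {ω | dec (m.view ω) ≠ W (m.base ω)}) * Real.log M - Real.log 2) +
      ((1 - 2 * P.real {ω | dec' (m.swap.view ω) ≠ W' (m.base ω)}) * Real.log M' -
        2 * Real.log 2) ≤
      ∑ t, (3 * m.up t + m.swap.up t - 2 * m.low ε B t) + 2 * l.toReal +
        2 * m.swap.up (Fin.last n) := by
  have f1 := m.fano_view hM hW hlaw hdec
  have f2 := m.swap.fano_view hM' hW' hlaw' hdec'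
  have a1 := m.klDiv_SY_add_mutual_le hM hW
  have a2 := m.two_mul_condKL_SY_le hW hB hgood
  have a3 := m.condKL_SYZ_le hW
  have a4 := m.swap.condKL_SY_le_add_mutual hM hW
  have a5 := m.condKL_pair_SYZ_ge hM hW hW' hind
  have a6 := m.condKL_SYZ_le (hW.prodMk hW')
  have a7 := m.swap.condKL_pair_SY_le hM hM' hW hW' hind hlaw'
  have a8 := m.swap.two_mul_condKL_SY_le hW' hB hgood'
  have a8' := m.condKL_swap_SYZ_le hW'
  have a9 := m.swap.klDiv_SY_add_mutual_le hM' hW'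
  have n1 := m.condKL_SY_ne_top hW
  have n2 := m.swap.condKL_SY_ne_top hW
  have n3 := m.swap.condKL_SY_ne_top hW'
  have n4 := m.swap.condKL_SY_ne_top (hW.prodMk hW')
  have hsum : ∀ f : Fin (n + 1) → ℝ, ∑ t, ENNReal.ofReal (f t) ≠ ∞ := fun f =>
    ENNReal.sum_ne_top.2 fun t _ => ENNReal.ofReal_ne_top
  have hleak' := ne_top_of_le_ne_top hl hleak
  obtain ⟨hi, hi', hg, hg', key⟩ := combine_bounds a1 a2 a3 a4 a5 a6 a7 a8 a8' a9 (hsum _) (hsum _)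
    n1 n2 n4 n3 hleak' ENNReal.ofReal_ne_top ENNReal.ofReal_ne_top
  have e1 := (ENNReal.ofReal_le_iff_le_toReal hi).1 f1
  -- The information on `W'` occurs twice on the left of `key`, against one log M' on the right.
  -- This leaves the coefficient 1 - 2 × (error probability).
  have e2 := (ENNReal.ofReal_le_iff_le_toReal hi').1 f2
  have e3 := toReal_sum_ofReal_le Finset.univ (m.low ε B)
  have e4 := toReal_sum_ofReal_le Finset.univ (m.swap.low ε B)
  have e5 := ENNReal.toReal_mono hl hleak
  have e6 : ∑ t, m.swap.low ε B t = ∑ t, m.low ε B t :=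
    Finset.sum_congr rfl fun t _ => by rw [low, low, min_comm]; rfl
  have hlog : 0 ≤ Real.log M' := Real.log_nonneg (by exact_mod_cast hM')
  rw [toReal_sum_ofReal _ m.up_nonneg, toReal_sum_ofReal _ m.swap.up_nonneg,
    ENNReal.toReal_ofReal hlog, ENNReal.toReal_ofReal (m.swap.up_nonneg _)] at key
  rw [Finset.sum_sub_distrib, Finset.sum_add_distrib, ← Finset.mul_sum, ← Finset.mul_sum]
  rw [e6] at e4
  change ∑ t, m.low ε B t ≤ _ at e3
  simp only [low, swap] at *
  linarith

end Transmission

namespace Transmission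

variable {Ω β : Type*} [MeasurableSpace Ω] [MeasurableSpace β]
  {P : Measure Ω} [IsProbabilityMeasure P]
  {ν : Measure State} [IsProbabilityMeasure ν] {p q : State → Vec} {n : ℕ}

/-- The part of the per-letter bounds that does not grow with the power. -/
noncomputable def excess (ν : Measure State) (p q : State → Vec) (B : ℝ) : ℝ :=
  3 * (2 * ∫ s, ∑ i, ‖p s i‖ ^ 2 ∂ν + 2 * noisePower) +
    (2 * ∫ s, ∑ i, ‖q s i‖ ^ 2 ∂ν + 2 * noisePower) + 2 * Real.log (1 + B) + 18 * noisePower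

/-- The outer bound for a code of finite block length in terms of the link exponents. -/
theorem rate_bound_exponents (m : Transmission (β := β) P ν p q n) (hn : 0 < n) {M M' : ℕ}
    (hM : 0 < M) (hM' : 0 < M') {W : β → Fin M} (hW : Measurable W) {W' : β → Fin M'}
    (hW' : Measurable W') (hlaw : P.map (fun ω => W (m.base ω)) = uniformOn Set.univ)
    (hlaw' : P.map (fun ω => W' (m.base ω)) = uniformOn Set.univ)
    (hind : P.map (fun ω => (W (m.base ω), W' (m.base ω))) =
      (P.map fun ω => W (m.base ω)).prod (P.map fun ω => W' (m.base ω)))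
    {dec : View n → Fin M} (hdec : Measurable dec)
    {dec' : View n → Fin M'} (hdec' : Measurable dec') {ε B : ℝ} (hε : 0 ≤ ε) (hB : 0 ≤ B)
    (hgood : 1 - ε ≤ (ν.prod ν).real (goodPairs p q B))
    (hgood' : 1 - ε ≤ (ν.prod ν).real (goodPairs q p B)) {l : ℝ≥0∞} (hl : l ≠ ∞)
    (hleak : klDiv (P.map fun ω => (W (m.base ω), m.swap.view ω))
        ((P.map fun ω => W (m.base ω)).prod (P.map m.swap.view)) ≤ l)
    {ρ : ℝ} (hρ : 1 ≤ ρ) {a b : Fin n → ℝ} (ha : ∀ t, m.r t ^ 2 = ρ ^ a t)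
    (hb : ∀ t, m.r' t ^ 2 = ρ ^ b t) (hb0 : ∀ t, 0 ≤ b t) (hb1 : ∀ t, b t ≤ 1) {K : ℝ}
    (hK : excess ν p q B ≤ K) :
    3 * ((1 - P.real {ω | dec (m.view ω) ≠ W (m.base ω)}) * Real.log M - Real.log 2) +
      ((1 - 2 * P.real {ω | dec' (m.swap.view ω) ≠ W' (m.base ω)}) * Real.log M' -
        2 * Real.log 2) ≤
      Real.log ρ * (∑ t, (2 * a t + |a t - b t|) + 2 * ε * n) + n * K + 2 * l.toReal +
        2 * (Real.log ρ + K) := by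
  unfold excess at hK
  -- A last letter must exist.
  obtain ⟨k, rfl⟩ := Nat.exists_eq_succ_of_ne_zero hn.ne'
  refine (m.rate_bound hM hM' hW hW' hlaw hlaw' hind hdec hdec' hB hgood hgood' hl hleak).trans ?_
  have hρ0 : 0 < ρ := by linarith
  have hlρ : 0 ≤ Real.log ρ := Real.log_nonneg hρ
  have hr : ∀ t, Real.log (m.r t ^ 2) = a t * Real.log ρ := fun t => by
    rw [ha, Real.log_rpow hρ0]
  have hr' : ∀ t, Real.log (m.r' t ^ 2) = b t * Real.log ρ := fun t => by
    rw [hb, Real.log_rpow hρ0]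
  have hp0 : 0 ≤ ∫ s, ∑ i, ‖p s i‖ ^ 2 ∂ν := integral_nonneg fun _ => by positivity
  have hq0 : 0 ≤ ∫ s, ∑ i, ‖q s i‖ ^ 2 ∂ν := integral_nonneg fun _ => by positivity
  have hN := noisePower_nonneg
  have hL : 0 ≤ Real.log (1 + B) := Real.log_nonneg (by linarith)
  have hlast : m.swap.up (Fin.last k) ≤ Real.log ρ + K := by
    change Real.log (m.r' _ ^ 2) + _ ≤ _
    rw [hr']
    nlinarith [hb1 (Fin.last k)]
  -- The exponents combine as 3a + b - 2 min(a,b) = 2a + |a-b|. The factor 1-ε on the minimum costs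
  -- at most 2ε, since min(a,b) ≤ 1.
  have hterm : ∀ t, 3 * m.up t + m.swap.up t - 2 * m.low ε B t ≤
      Real.log ρ * (2 * a t + |a t - b t| + 2 * ε) + K := by
    intro t
    change 3 * (Real.log (m.r t ^ 2) + _) + (Real.log (m.r' t ^ 2) + _) - 2 * m.low ε B t ≤ _
    rw [low, hr, hr', ← min_mul_of_nonneg _ _ hlρ]
    have h1 : min (a t) (b t) ≤ 1 := (min_le_right _ _).trans (hb1 t)
    have h2 : 2 * min (a t) (b t) = a t + b t - |a t - b t| := by
      rcases le_total (a t) (b t) with h | h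
      · rw [min_eq_left h, abs_of_nonpos (by linarith)]; ring
      · rw [min_eq_right h, abs_of_nonneg (by linarith)]; ring
    have h3 : ε * (min (a t) (b t) * Real.log ρ) ≤ ε * Real.log ρ :=
      mul_le_mul_of_nonneg_left (by nlinarith) hε
    have h4 : 2 * (min (a t) (b t) * Real.log ρ) = (a t + b t - |a t - b t|) * Real.log ρ := by
      rw [← h2]; ring
    nlinarith
  have hsum := Finset.sum_le_sum fun t (_ : t ∈ Finset.univ) => hterm t
  rw [Finset.sum_add_distrib, ← Finset.mul_sum, Finset.sum_add_distrib] at hsum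
  simp only [Finset.sum_const, Finset.card_univ, Fintype.card_fin, nsmul_eq_mul] at hsum
  push_cast at hsum ⊢
  linarith

end Transmission

/-! ### Codes as transmissions. -/

theorem Link.exponent_nonneg {α : ℝ} (hα : 0 ≤ α) (x : Link) : 0 ≤ x.exponent α := by
  cases x <;> simp [Link.exponent, hα]

theorem Link.exponent_le_one {α : ℝ} (hα : α ≤ 1) (x : Link) : x.exponent α ≤ 1 := by
  cases x <;> simp [Link.exponent, hα]

namespace Code

variable {n : ℕ} (C : Code n) (ν : Measure State) [IsProbabilityMeasure ν]

instance : Nonempty (Fin C.M₁) := ⟨⟨0, C.pos₁⟩⟩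

instance : Nonempty (Fin C.M₂) := ⟨⟨0, C.pos₂⟩⟩

instance : IsProbabilityMeasure (C.law ν) := by unfold law; infer_instance

theorem one_le_gain {ρ e : ℝ} (hρ : 1 ≤ ρ) (he : 0 ≤ e) : 1 ≤ Real.sqrt (ρ ^ e) :=
  Real.one_le_sqrt.2 (Real.one_le_rpow hρ he)

theorem gain_sq {ρ : ℝ} (hρ : 1 ≤ ρ) (e : ℝ) : Real.sqrt (ρ ^ e) ^ 2 = ρ ^ e :=
  Real.sq_sqrt (Real.rpow_nonneg (by linarith) _)

theorem measurable_enc_uncurry (t : Fin n) : Measurable fun x :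
    ((Fin C.M₁ × Fin C.M₂) × C.Θ) × (Fin (t : ℕ) → State) =>
      C.enc t x.1.1.1 x.1.1.2 x.2 x.1.2 := by
  have h : Measurable fun x : (Fin C.M₁ × Fin C.M₂) × ((Fin (t : ℕ) → State) × C.Θ) =>
      C.enc t x.1.1 x.1.2 x.2.1 x.2.2 :=
    measurable_from_prod_countable_right fun w => C.measurable_enc t w.1 w.2
  exact h.comp (by fun_prop : Measurable fun x :
    ((Fin C.M₁ × Fin C.M₂) × C.Θ) × (Fin (t : ℕ) → State) => (x.1.1, (x.2, x.1.2)))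

theorem map_fst_law : (C.law ν).map Prod.fst =
    ((uniformOn Set.univ).prod (uniformOn Set.univ)).prod C.lawΘ :=
  measurePreserving_fst.map_eq

variable {α : ℝ} (hα : 0 ≤ α) {ρ : ℝ} (hρ : 1 ≤ ρ) (A : Fin n → Link × Link)

/-- The use of the channel by a code. -/
noncomputable def transmission {ν : Measure State} [IsProbabilityMeasure ν] (hν : IsFadingLaw ν) :
    Transmission (β := (Fin C.M₁ × Fin C.M₂) × C.Θ) (C.law ν) ν Prod.fst Prod.snd n where
  base := fun ω => ω.1
  S := fun ω => ω.2.1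
  N := fun ω => ω.2.2.1
  N' := fun ω => ω.2.2.2
  enc := fun t b s => C.enc t b.1.1 b.1.2 s b.2
  r := fun t => Real.sqrt (ρ ^ (A t).1.exponent α)
  r' := fun t => Real.sqrt (ρ ^ (A t).2.exponent α)
  measurable_base := measurable_fst
  measurable_S := by fun_prop
  measurable_N := by fun_prop
  measurable_N' := by fun_prop
  measurable_enc := C.measurable_enc_uncurry
  power := fun _ _ _ => C.power _ _ _ _ _
  one_le_r := fun _ => one_le_gain hρ (Link.exponent_nonneg hα _)
  one_le_r' := fun _ => one_le_gain hρ (Link.exponent_nonneg hα _)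
  law := by
    have h : (C.law ν).map (fun ω => ω.1) =
      ((uniformOn Set.univ).prod (uniformOn Set.univ)).prod C.lawΘ := C.map_fst_law ν
    rw [h]
    exact Measure.map_id
  measurable_p := measurable_fst
  measurable_q := measurable_snd
  integrable_p := hν.power_fst
  integrable_q := hν.power_snd
  join := fun u v => (u, v)
  measurable_join := measurable_id
  join_eq := fun _ => rfl

theorem map_msg₁ : (C.law ν).map C.msg₁ = uniformOn Set.univ :=
  (measurePreserving_fst.comp (measurePreserving_fst.comp measurePreserving_fst)).map_eq

theorem map_msg₂ : (C.law ν).map C.msg₂ = uniformOn Set.univ :=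
  (measurePreserving_snd.comp (measurePreserving_fst.comp measurePreserving_fst)).map_eq

theorem map_msgs : (C.law ν).map (fun ω => (C.msg₁ ω, C.msg₂ ω)) =
    ((C.law ν).map C.msg₁).prod ((C.law ν).map C.msg₂) := by
  rw [map_msg₁, map_msg₂]
  exact (measurePreserving_fst.comp measurePreserving_fst).map_eq

theorem map_msgs_swap : (C.law ν).map (fun ω => (C.msg₂ ω, C.msg₁ ω)) =
    ((C.law ν).map C.msg₂).prod ((C.law ν).map C.msg₁) := by
  rw [map_msg₁, map_msg₂]
  exact (Measure.measurePreserving_swap.comp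
    (measurePreserving_fst.comp measurePreserving_fst)).map_eq

end Code

/-- Outer bound on the rates of a code of finite block length. -/
theorem exists_rate_bound {ν : Measure State} [IsProbabilityMeasure ν] (hν : IsFadingLaw ν)
    {ε : ℝ} (hε : 0 < ε) : ∃ K : ℝ, ∀ (α : ℝ), 0 ≤ α → α ≤ 1 → ∀ (ρ : ℝ), 1 ≤ ρ → ∀ (n : ℕ), 0 < n →
    ∀ (A : Fin n → Link × Link) (C : Code n),
    (C.leak₁ ν α A ρ ≠ ∞ →
      3 * ((1 - (C.err₁ ν α A ρ).toReal) * Real.log C.M₁ - Real.log 2) +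
      ((1 - 2 * (C.err₂ ν α A ρ).toReal) * Real.log C.M₂ - 2 * Real.log 2) ≤
      Real.log ρ * (∑ t, (2 * (A t).1.exponent α +
        |(A t).1.exponent α - (A t).2.exponent α|) + 2 * ε * n) + n * K +
        2 * (C.leak₁ ν α A ρ).toReal + 2 * (Real.log ρ + K)) ∧
    (C.leak₂ ν α A ρ ≠ ∞ →
      3 * ((1 - (C.err₂ ν α A ρ).toReal) * Real.log C.M₂ - Real.log 2) +
      ((1 - 2 * (C.err₁ ν α A ρ).toReal) * Real.log C.M₁ - 2 * Real.log 2) ≤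
      Real.log ρ * (∑ t, (2 * (A t).2.exponent α +
        |(A t).2.exponent α - (A t).1.exponent α|) + 2 * ε * n) + n * K +
        2 * (C.leak₂ ν α A ρ).toReal + 2 * (Real.log ρ + K)) := by
  obtain ⟨B₁, hB₁, hg₁⟩ := exists_goodPairs measurable_fst measurable_snd ν hν.full_rank_fst hε
  obtain ⟨B₂, hB₂, hg₂⟩ := exists_goodPairs measurable_snd measurable_fst ν hν.full_rank_snd hε
  have hmono : ∀ (p q : State → Vec) {B B' : ℝ}, B ≤ B' →
      (ν.prod ν).real (goodPairs p q B) ≤ (ν.prod ν).real (goodPairs p q B') := fun p q B B' h =>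
    measureReal_mono fun x hx => ⟨hx.1, hx.2.1.trans h, hx.2.2.trans h⟩
  have hB : 0 ≤ max B₁ B₂ := hB₁.trans (le_max_left _ _)
  replace hg₁ := hg₁.trans (hmono _ _ (le_max_left B₁ B₂))
  replace hg₂ := hg₂.trans (hmono _ _ (le_max_right B₁ B₂))
  -- The good sets grow with the bound, so the larger one serves both receivers. The constant
  -- depends on `ν` and `ε` alone, so it survives n → ∞ and is negligible against log ρ.
  refine ⟨max (Transmission.excess ν Prod.fst Prod.snd (max B₁ B₂))
    (Transmission.excess ν Prod.snd Prod.fst (max B₁ B₂)),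
    fun α hα hα1 ρ hρ n hn A C => ⟨fun hl => ?_, fun hl => ?_⟩⟩
  · have h := (C.transmission hα hρ A hν).rate_bound_exponents hn C.pos₁ C.pos₂
      (W := fun b => b.1.1) (by fun_prop) (W' := fun b => b.1.2) (by fun_prop) (C.map_msg₁ ν)
      (C.map_msg₂ ν) (C.map_msgs ν) C.measurable_dec₁ C.measurable_dec₂ hε.le hB hg₁ hg₂ hl le_rfl
      hρ (fun t => Code.gain_sq hρ _) (fun t => Code.gain_sq hρ _)
      (fun t => Link.exponent_nonneg hα _) (fun t => Link.exponent_le_one hα1 _) (le_max_left (Transmission.excess ν Prod.fst Prod.snd (max B₁ B₂))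
        (Transmission.excess ν Prod.snd Prod.fst (max B₁ B₂)))
    exact h
  · have h := (C.transmission hα hρ A hν).swap.rate_bound_exponents hn C.pos₂ C.pos₁
      (W := fun b => b.1.2) (by fun_prop) (W' := fun b => b.1.1) (by fun_prop) (C.map_msg₂ ν)
      (C.map_msg₁ ν) (C.map_msgs_swap ν) C.measurable_dec₂ C.measurable_dec₁ hε.le hB hg₂ hg₁ hl
      le_rfl hρ (fun t => Code.gain_sq hρ _) (fun t => Code.gain_sq hρ _)
      (fun t => Link.exponent_nonneg hα _) (fun t => Link.exponent_le_one hα1 _) (le_max_right (Transmission.excess ν Prod.fst Prod.snd (max B₁ B₂))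
        (Transmission.excess ν Prod.snd Prod.fst (max B₁ B₂)))
    exact h

/-! ### Limits in the block length and in the power. -/

instance : Fintype Link where
  elems := Finset.cons .strong {.weak} (by simp)
  complete := by rintro (_ | _) <;> simp

theorem Link.sum_eq (f : Link → ℝ) : ∑ x, f x = f .strong + f .weak := by
  rw [show (Finset.univ : Finset Link) = Finset.cons .strong {.weak} (by simp) from rfl,
    Finset.sum_cons, Finset.sum_singleton]

/-- Times are grouped by their topology state, and each group's share converges. -/
theorem HasFractions.tendsto_average {A : Schedule} {lam : Link → Link → ℝ}
    (hA : HasFractions A lam) (f : Link × Link → ℝ) :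
    Tendsto (fun n : ℕ => (∑ t, f (A n t)) / n) atTop (𝓝 (∑ a, ∑ b, lam a b * f (a, b))) := by
  classical
  have hsum : ∀ n, ∑ t, f (A n t) =
      ∑ x : Link × Link, (Nat.card {t : Fin n // A n t = x} : ℝ) * f x := fun n => by
    rw [← Finset.sum_fiberwise (g := A n)]
    refine Finset.sum_congr rfl fun x _ => ?_
    rw [Finset.sum_congr rfl (g := fun _ => f x) fun t ht => by rw [(Finset.mem_filter.1 ht).2],
      Finset.sum_const, nsmul_eq_mul, Nat.card_eq_fintype_card, Fintype.card_subtype]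
  simp_rw [hsum, Finset.sum_div, Fintype.sum_prod_type]
  refine tendsto_finsetSum _ fun a _ => tendsto_finsetSum _ fun b _ => ?_
  refine ((hA a b).mul_const (f (a, b))).congr fun n => ?_
  rw [div_mul_eq_mul_div]

theorem tendsto_zero_of_limsup_eq_zero {u : ℕ → ℝ≥0∞} (h : limsup u atTop = 0) :
    Tendsto u atTop (𝓝 0) :=
  tendsto_of_le_liminf_of_limsup_le zero_le h.le

theorem tendsto_toReal_zero {u : ℕ → ℝ≥0∞} (h : limsup u atTop = 0) :
    Tendsto (fun n => (u n).toReal) atTop (𝓝 0) :=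
  (ENNReal.tendsto_toReal ENNReal.zero_ne_top).comp (tendsto_zero_of_limsup_eq_zero h)

/-- An infinite value stays infinite after division by n. So vanishing normalized leakage supplies
the finiteness that the finite-block bound requires. -/
theorem eventually_ne_top_of_limsup_div {u : ℕ → ℝ≥0∞}
    (h : limsup (fun n : ℕ => u n / (n : ℝ≥0∞)) atTop = 0) : ∀ᶠ n in atTop, u n ≠ ∞ := by
  filter_upwards [(tendsto_zero_of_limsup_eq_zero h).eventually (gt_mem_nhds (zero_lt_one (α := ℝ≥0∞)))]
    with n hn hu
  rw [hu, ENNReal.top_div_of_ne_top (ENNReal.natCast_ne_top n)] at hn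
  exact absurd hn (by simp)

/-- The slack `η` makes the inequality strict, which unpacks the nested lower limits; the threshold
for n may depend on ρ. -/
theorem eventually_log_ge {M : ℝ → ℕ → ℕ} {d : ℝ} (h : (d : EReal) ≤ gsdofOf M) {η : ℝ}
    (hη : 0 < η) : ∀ᶠ ρ : ℝ in atTop, ∀ᶠ n : ℕ in atTop,
      (d - η) * (n * Real.log ρ) ≤ Real.log (M ρ n) := by
  have h1 : ((d - η : ℝ) : EReal) < gsdofOf M :=
    lt_of_lt_of_le (EReal.coe_lt_coe_iff.2 (by linarith)) h
  filter_upwards [eventually_lt_of_lt_liminf h1, eventually_gt_atTop 1] with ρ hρ hρ1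
  filter_upwards [eventually_lt_of_lt_liminf hρ, eventually_gt_atTop 0] with n hn hn0
  have hpos : 0 < n * Real.log ρ := mul_pos (Nat.cast_pos.2 hn0) (Real.log_pos hρ1)
  exact ((lt_div_iff₀ hpos).1 (EReal.coe_lt_coe_iff.1 hn)).le

/-- The passage from finite-block rate bounds to a bound on the normalized rates: first the block
length and then the power tend to infinity. -/
theorem gsdof_le_of_rate_bound {M M' : ℝ → ℕ → ℕ} {e e' l : ℝ → ℕ → ℝ≥0∞} {S : ℕ → ℝ}
    {d d' Λ : ℝ} (hd : (d : EReal) ≤ gsdofOf M) (hd' : (d' : EReal) ≤ gsdofOf M')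
    (hS : Tendsto (fun n : ℕ => S n / n) atTop (𝓝 Λ))
    (hlim : ∀ᶠ ρ : ℝ in atTop, limsup (e ρ) atTop = 0 ∧ limsup (e' ρ) atTop = 0 ∧
      limsup (fun n : ℕ => l ρ n / (n : ℝ≥0∞)) atTop = 0)
    (hrate : ∀ ε : ℝ, 0 < ε → ∃ K : ℝ, ∀ ρ : ℝ, 1 ≤ ρ → ∀ n : ℕ, 0 < n → l ρ n ≠ ∞ →
      3 * ((1 - (e ρ n).toReal) * Real.log (M ρ n) - Real.log 2) +
      ((1 - 2 * (e' ρ n).toReal) * Real.log (M' ρ n) - 2 * Real.log 2) ≤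
      Real.log ρ * (S n + 2 * ε * n) + n * K + 2 * (l ρ n).toReal + 2 * (Real.log ρ + K)) :
    3 * d + d' ≤ Λ := by
  suffices key : ∀ ε : ℝ, 0 < ε → 3 * (d - ε) + (d' - ε) ≤ Λ + 2 * ε by
    refine le_of_forall_pos_le_add fun δ hδ => ?_
    -- The slack adds up to 3ε + ε + 2ε = 6ε.
    have := key (δ / 6) (by positivity)
    linarith
  intro ε hε
  obtain ⟨K, hK⟩ := hrate ε hε
  -- At fixed ρ, division by n removes the log 2 terms, the leakage and the last-letter cost. Only
  -- the per-letter constant `K` remains, and division by log ρ removes it in the next limit.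
  have hfix : ∀ᶠ ρ : ℝ in atTop, 3 * (d - ε) + (d' - ε) ≤ Λ + 2 * ε + K / Real.log ρ := by
    filter_upwards [hlim, eventually_log_ge hd hε, eventually_log_ge hd' hε,
      eventually_gt_atTop 1] with ρ ⟨he, he', hl⟩ hM hM' hρ
    have hlog : 0 < Real.log ρ := Real.log_pos hρ
    have te := tendsto_toReal_zero he
    have te' := tendsto_toReal_zero he'
    have tl := tendsto_toReal_zero hl
    have tn : Tendsto (fun n : ℕ => ((n : ℝ))⁻¹) atTop (𝓝 0) := tendsto_inv_atTop_nhds_zero_nat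
    have hL : Tendsto (fun n : ℕ => 3 * ((1 - (e ρ n).toReal) * ((d - ε) * Real.log ρ) -
        Real.log 2 * (n : ℝ)⁻¹) + ((1 - 2 * (e' ρ n).toReal) * ((d' - ε) * Real.log ρ) -
        2 * Real.log 2 * (n : ℝ)⁻¹)) atTop
        (𝓝 (3 * ((1 - 0) * ((d - ε) * Real.log ρ) - Real.log 2 * 0) +
          ((1 - 2 * 0) * ((d' - ε) * Real.log ρ) - 2 * Real.log 2 * 0))) :=
      ((((te.const_sub 1).mul_const _).sub (tn.const_mul _)).const_mul 3).add
        ((((te'.const_mul 2).const_sub 1).mul_const _).sub (tn.const_mul _))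
    have hR : Tendsto (fun n : ℕ => Real.log ρ * (S n / n + 2 * ε) + K +
        2 * (l ρ n / (n : ℝ≥0∞)).toReal + 2 * (Real.log ρ + K) * (n : ℝ)⁻¹) atTop
        (𝓝 (Real.log ρ * (Λ + 2 * ε) + K + 2 * 0 + 2 * (Real.log ρ + K) * 0)) :=
      ((((hS.add_const _).const_mul _).add_const K).add (tl.const_mul 2)).add (tn.const_mul _)
    have hle := le_of_tendsto_of_tendsto hL hR (by
      filter_upwards [hM, hM', eventually_ne_top_of_limsup_div hl, eventually_gt_atTop 0,
        te.eventually (gt_mem_nhds (by norm_num : (0 : ℝ) < 1 / 2)),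
        te'.eventually (gt_mem_nhds (by norm_num : (0 : ℝ) < 1 / 2))] with n h1 h2 h3 hn h4 h5
      have hn' : (0 : ℝ) < n := Nat.cast_pos.2 hn
      -- Replacing log M by its lower bound needs nonnegative coefficients; this is why both error
      -- probabilities were taken below 1/2.
      have h6 := mul_le_mul_of_nonneg_left h1 (by linarith : 0 ≤ 1 - (e ρ n).toReal)
      have h7 := mul_le_mul_of_nonneg_left h2 (by linarith : 0 ≤ 1 - 2 * (e' ρ n).toReal)
      have h8 := hK ρ hρ.le n hn h3
      rw [ENNReal.toReal_div, ENNReal.toReal_natCast]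
      refine le_of_mul_le_mul_right ?_ hn'
      have e1 : (3 * ((1 - (e ρ n).toReal) * ((d - ε) * Real.log ρ) -
          Real.log 2 * (n : ℝ)⁻¹) + ((1 - 2 * (e' ρ n).toReal) * ((d' - ε) * Real.log ρ) -
          2 * Real.log 2 * (n : ℝ)⁻¹)) * n =
          3 * ((1 - (e ρ n).toReal) * ((d - ε) * (n * Real.log ρ)) - Real.log 2) +
          ((1 - 2 * (e' ρ n).toReal) * ((d' - ε) * (n * Real.log ρ)) - 2 * Real.log 2) := by
        field_simp
      have e2 : (Real.log ρ * (S n / n + 2 * ε) + K + 2 * ((l ρ n).toReal / n) +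
          2 * (Real.log ρ + K) * (n : ℝ)⁻¹) * n = Real.log ρ * (S n + 2 * ε * n) + n * K +
          2 * (l ρ n).toReal + 2 * (Real.log ρ + K) := by
        field_simp
      rw [e1, e2]
      linarith)
    refine le_of_mul_le_mul_right ?_ hlog
    have e3 : (Λ + 2 * ε + K / Real.log ρ) * Real.log ρ = Real.log ρ * (Λ + 2 * ε) + K := by
      field_simp
    rw [e3]
    linarith
  have hlim0 : Tendsto (fun ρ : ℝ => Λ + 2 * ε + K / Real.log ρ) atTop (𝓝 (Λ + 2 * ε + 0)) :=
    (Real.tendsto_log_atTop.const_div_atTop K).const_add _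
  simpa using ge_of_tendsto hlim0 hfix

end MisoBC

theorem theorem2 (α : ℝ) (hα0 : 0 ≤ α) (hα1 : α ≤ 1)
    (ν : Measure MisoBC.State) [IsProbabilityMeasure ν] (hν : MisoBC.IsFadingLaw ν)
    (A : MisoBC.Schedule) (lam : MisoBC.Link → MisoBC.Link → ℝ)
    (hA : MisoBC.HasFractions A lam) :
    MisoBC.gsdofRegion ν α A ⊆
      {d : ℝ × ℝ | 0 ≤ d.1 ∧ 0 ≤ d.2 ∧
        3 * d.1 + d.2 ≤
          (3 - α) * lam .strong .weak + 2 * (lam .strong .strong + α * lam .weak .weak)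
            + (1 + α) * lam .weak .strong ∧
        d.1 + 3 * d.2 ≤
          (3 - α) * lam .weak .strong + 2 * (lam .strong .strong + α * lam .weak .weak)
            + (1 + α) * lam .strong .weak} := by
  rintro d ⟨h1, h2, C, hC, hd1, hd2⟩
  have habs : |α - 1| = 1 - α := by rw [abs_sub_comm, abs_of_nonneg (by linarith)]
  have habs' : |1 - α| = 1 - α := abs_of_nonneg (by linarith)
  refine ⟨h1, h2, ?_, ?_⟩
  -- The weight 2a + |a-b| equals 2, 3-α, 1+α and 2α in the states (strong, strong), (strong, weak),
  -- (weak, strong) and (weak, weak). Only the leakage of the first message enters this bound.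
  · refine (MisoBC.gsdof_le_of_rate_bound hd1 hd2 (hA.tendsto_average fun x =>
      2 * x.1.exponent α + |x.1.exponent α - x.2.exponent α|)
      (hC.mono fun ρ h => ⟨h.1, h.2.1, h.2.2.2⟩) fun ε hε => ?_).trans_eq ?_
    · obtain ⟨K, hK⟩ := MisoBC.exists_rate_bound hν hε
      exact ⟨K, fun ρ hρ n hn => (hK α hα0 hα1 ρ hρ n hn (A n) (C ρ n)).1⟩
    · simp only [MisoBC.Link.sum_eq, MisoBC.Link.exponent, sub_self, abs_zero, habs, habs']
      ring
  · rw [add_comm]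
    refine (MisoBC.gsdof_le_of_rate_bound hd2 hd1 (hA.tendsto_average fun x =>
      2 * x.2.exponent α + |x.2.exponent α - x.1.exponent α|)
      (hC.mono fun ρ h => ⟨h.2.1, h.1, h.2.2.1⟩) fun ε hε => ?_).trans_eq ?_
    · obtain ⟨K, hK⟩ := MisoBC.exists_rate_bound hν hε
      exact ⟨K, fun ρ hρ n hn => (hK α hα0 hα1 ρ hρ n hn (A n) (C ρ n)).2⟩
    · simp only [MisoBC.Link.sum_eq, MisoBC.Link.exponent, sub_self, abs_zero, habs, habs']
      ring
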